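/- **Conventions.** A foliation of degree $d$ on $\mathbb{CP}^2$ (homogeneous coordinates $(x:y:z)$) is defined by a 1-form $\omega=A\,dx+B\,dy+C\,dz$ with $A,B,C\in\mathbb{C}[x,y,z]$ homogeneous of degree $d+1$, without common factor, and $xA+yB+zC=0$; its singular points are the common zeros of $A,B,C$. A (rational) map $T$ of the plane given by homogeneous polynomials transforms the foliation of $\omega$ into the foliation of $\eta$ if $T^*\omega=h\,\eta$ for some nonzero polynomial $h$. Write the foliation near a point, in affine coordinates $(u,v)$ centred at it, as $p\,du+q\,dv$. The multiplicity of the point is the minimum of the orders of $p$ and $q$ there, and its Milnor number is $\dim_{\mathbb{C}}\mathbb{C}\{u,v\}/(p,q)$. A (formal) separatrix is a curve $f=0$ with $f\in\mathbb{C}[[u,v]]$ irreducible and $f\mid p\,\partial_v f-q\,\partial_u f$; it is divergent if no product of $f$ with a unit of $\mathbb{C}[[u,v]]$ converges. A singular point is a saddle-node if the linear part of $q\,\partial_u-p\,\partial_v$ there has one zero and one nonzero eigenvalue, and hyperbolic if both eigenvalues are nonzero and their quotient is not a positive rational number. The weak separatrix of a saddle-node is its smooth formal separatrix tangent to the kernel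 of the linear part. The reduction process blows up successively all singular points that are neither saddle-nodes nor hyperbolic. The foliation is of second type if, for no saddle-node in its reduction process, the weak separatrix is contained in a component of the exceptional divisor. **Statement.** Let $\omega_0=-(y^2z+xy(z-y))\,dx+x^2(z-y)\,dy+xy^2\,dz$. It defines a foliation of degree $2$, the projectivisation of Euler's foliation, being $y^2dz+(z-y)dy$ in the chart $x=1$. Transform it successively by 1. the linear change of coordinates $z\to z-x$, 2. the Cremona map $\rho_1(x:y:z)=(xy:y^2:x^2-yz)$, 3. the linear change of coordinates $y\to y-z$, 4. the Cremona map $\rho_2(x:y:z)=(x^2:xy:y^2-xz)$ (which is $\rho_1$ with the roles of $x$ and $y$ exchanged). The result is the foliation defined by $\tilde\omega=A\,dx+B\,dy+C\,dz$, where $$\begin{aligned}A={}&-x^7y-x^7z+4x^6y^2+4x^6yz+2x^6z^2-5x^5y^3-4x^5y^2z+x^5yz^2+x^4y^4-4x^4y^3z-3x^4y^2z^2-3x^4yz^3-x^4z^4+4x^3y^5+9x^3y^4z+12x^3y^3z^2+5x^3y^2z^3-6x^2y^6-15x^2y^5z-9x^2y^4z^2+6xy^7+7xy^6z-2y^8,\\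 B={}&x^8-4x^7y-2x^7z+5x^6y^2+3x^6yz-x^5y^3+2x^5y^2z-4x^4y^4-6x^4y^3z-6x^4y^2z^2-2x^4yz^3+6x^3y^5+12x^3y^4z+6x^3y^3z^2-6x^2y^6-6x^2y^5z+2xy^7,\\ C={}&x^8-2x^7y-2x^7z+x^6y^2-x^6yz+2x^5y^3+3x^5y^2z+3x^5yz^2+x^5z^3-3x^4y^4-6x^4y^3z-3x^4y^2z^2+3x^3y^5+3x^3y^4z-x^2y^6.\end{aligned}$$ This foliation has degree $7$, and $(0:0:1)$ is its only singular point. That point has multiplicity $4$ and Milnor number $57$, and there is a divergent separatrix through it. The line $x=0$ is invariant. The foliation is not of second type. -/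

import Mathlib

noncomputable section

namespace PlaneFoliation

open MvPolynomial

/-! ### Polynomial 1-forms and foliations on the projective plane -/

/-- A polynomial 1-form `∑ i, ω i dX_i` in `n` variables, given by its coefficients. -/
abbrev Form (n : ℕ) : Type := Fin n → MvPolynomial (Fin n) ℂ

/-- The pull-back `T^* ω = ∑ j, (ω j ∘ T) dT_j` of a 1-form by a polynomial map `T`. -/
def pullback {n m : ℕ} (T : Fin n → MvPolynomial (Fin m) ℂ) (ω : Form n) : Form m :=
  fun i => ∑ j, bind₁ T (ω j) * pderiv i (T j)

/-- `ω` is a homogeneous 1-form defining a foliation of degree `d` on the projective plane: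
its coefficients are homogeneous of degree `d + 1`, satisfy Euler's condition, and have no
common factor. -/
structure IsFoliation (d : ℕ) (ω : Form 3) : Prop where
  homogeneous : ∀ i, (ω i).IsHomogeneous (d + 1)
  euler : ∑ i, X i * ω i = 0
  no_common_factor : ∀ g : MvPolynomial (Fin 3) ℂ, (∀ i, g ∣ ω i) → IsUnit g

/-- `η` defines the foliation obtained from the one defined by `ω` by pulling back through the
(rational) self-map of the plane with homogeneous components `T`: it is a foliation, and `T^* ω`
is `η` times a nonzero polynomial. -/
def IsTransform (T : Fin 3 → MvPolynomial (Fin 3) ℂ) (ω η : Form 3) : Prop :=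
  (∃ d, IsFoliation d η) ∧ ∃ h : MvPolynomial (Fin 3) ℂ, h ≠ 0 ∧ pullback T ω = fun i => h * η i

/-- The singular points of the foliation defined by `ω`. -/
def singularSet (ω : Form 3) : Set (Projectivization ℂ (Fin 3 → ℂ)) :=
  {p | ∀ i, eval p.rep (ω i) = 0}

/-- The plane curve `f = 0` is invariant: `ω ∧ df = f η` for some 2-form `η`. -/
def IsInvariantPlaneCurve (ω : Form 3) (f : MvPolynomial (Fin 3) ℂ) : Prop :=
  ∀ i j, f ∣ ω i * pderiv j f - ω j * pderiv i f

/-- The restriction of `ω` to the affine chart `X_i = 1`, in affine coordinates centred at the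
point with homogeneous coordinates `v` (with `v i = 1`). The two affine coordinates are the
remaining homogeneous coordinates, in increasing order. -/
def localForm (ω : Form 3) (i : Fin 3) (v : Fin 3 → ℂ) : Form 2 :=
  fun j => bind₁ (i.insertNth 1 fun k => X k + C (v (i.succAbove k))) (ω (i.succAbove j))

/-! ### Local invariants at the origin of the affine plane -/

/-- A formal power series in two variables is convergent if it converges absolutely on some
polydisc around the origin. -/
def IsConvergent (f : MvPowerSeries (Fin 2) ℂ) : Prop :=
  ∃ r : ℝ, 0 < r ∧ Summable fun n : Fin 2 →₀ ℕ => ‖MvPowerSeries.coeff n f‖ * r ^ n.degree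

theorem IsConvergent.anti {f : MvPowerSeries (Fin 2) ℂ} {r s : ℝ} (hs : 0 < s) (hsr : s ≤ r)
    (h : Summable fun n : Fin 2 →₀ ℕ => ‖MvPowerSeries.coeff n f‖ * r ^ n.degree) :
    Summable fun n : Fin 2 →₀ ℕ => ‖MvPowerSeries.coeff n f‖ * s ^ n.degree :=
  Summable.of_nonneg_of_le (fun _ => by positivity) (fun _ => by gcongr) h

theorem isConvergent_coe (p : MvPolynomial (Fin 2) ℂ) :
    IsConvergent (p : MvPowerSeries (Fin 2) ℂ) := by
  refine ⟨1, one_pos, summable_of_ne_finset_zero (s := p.support) fun n hn => ?_⟩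
  rw [MvPolynomial.coeff_coe, MvPolynomial.notMem_support_iff.mp hn]
  simp

theorem IsConvergent.add {f g : MvPowerSeries (Fin 2) ℂ} (hf : IsConvergent f)
    (hg : IsConvergent g) : IsConvergent (f + g) := by
  obtain ⟨r, hr, hf⟩ := hf
  obtain ⟨s, hs, hg⟩ := hg
  have ht : 0 < min r s := lt_min hr hs
  refine ⟨min r s, ht, Summable.of_nonneg_of_le (fun _ => by positivity) (fun n => ?_)
    ((IsConvergent.anti ht (min_le_left r s) hf).add
      (IsConvergent.anti ht (min_le_right r s) hg))⟩
  rw [map_add, ← add_mul]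
  gcongr
  exact norm_add_le _ _

theorem IsConvergent.mul {f g : MvPowerSeries (Fin 2) ℂ} (hf : IsConvergent f)
    (hg : IsConvergent g) : IsConvergent (f * g) := by
  obtain ⟨r, hr, hf⟩ := hf
  obtain ⟨s, hs, hg⟩ := hg
  have ht : 0 < min r s := lt_min hr hs
  have hf' := IsConvergent.anti ht (min_le_left r s) hf
  have hg' := IsConvergent.anti ht (min_le_right r s) hg
  set t := min r s
  set F : (Fin 2 →₀ ℕ) → ℝ := fun n => ‖MvPowerSeries.coeff n f‖ * t ^ n.degree with hF
  set G : (Fin 2 →₀ ℕ) → ℝ := fun n => ‖MvPowerSeries.coeff n g‖ * t ^ n.degree with hG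
  have hF0 : 0 ≤ F := fun n => mul_nonneg (norm_nonneg _) (pow_nonneg ht.le _)
  have hG0 : 0 ≤ G := fun n => mul_nonneg (norm_nonneg _) (pow_nonneg ht.le _)
  have hFG : Summable fun p : (Fin 2 →₀ ℕ) × (Fin 2 →₀ ℕ) => F p.1 * G p.2 :=
    Summable.mul_of_nonneg hf' hg' hF0 hG0
  have hsum := summable_sum_mul_antidiagonal_of_summable_mul hFG
  refine ⟨t, ht, Summable.of_nonneg_of_le
    (fun n => mul_nonneg (norm_nonneg _) (pow_nonneg ht.le _)) (fun n => ?_) hsum⟩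
  rw [MvPowerSeries.coeff_mul]
  refine (mul_le_mul_of_nonneg_right (norm_sum_le _ _) (pow_nonneg ht.le _)).trans ?_
  rw [Finset.sum_mul]
  refine Finset.sum_le_sum fun kl hkl => ?_
  rw [Finset.HasAntidiagonal.mem_antidiagonal] at hkl
  rw [← hkl, map_add, pow_add, norm_mul]
  exact le_of_eq (by simp only [hF, hG]; ring)

/-- The ring `ℂ{x, y}` of convergent power series, that is, of germs of holomorphic functions at
the origin of `ℂ²`. -/
def ConvergentSeries : Subalgebra ℂ (MvPowerSeries (Fin 2) ℂ) where
  carrier := {f | IsConvergent f}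
  mul_mem' := IsConvergent.mul
  add_mem' := IsConvergent.add
  algebraMap_mem' c := by
    have h := isConvergent_coe (C c)
    rwa [MvPolynomial.coe_C] at h

/-- The germ at the origin of a polynomial. -/
def germ (p : MvPolynomial (Fin 2) ℂ) : ConvergentSeries :=
  ⟨(p : MvPowerSeries (Fin 2) ℂ), isConvergent_coe p⟩

/-- The Milnor number at the origin of the foliation defined by `ω 0 dx + ω 1 dy`. -/
def milnorNumber (ω : Form 2) : ℕ :=
  Module.finrank ℂ (ConvergentSeries ⧸ Ideal.span {germ (ω 0), germ (ω 1)})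

/-- The multiplicity at the origin of the foliation defined by `ω 0 dx + ω 1 dy`. -/
def multiplicity (ω : Form 2) : ℕ∞ :=
  min (ω 0 : MvPowerSeries (Fin 2) ℂ).order (ω 1 : MvPowerSeries (Fin 2) ℂ).order

/-! ### Separatrices -/

/-- The formal curve `f = 0` is a (formal) separatrix through the origin of the foliation defined
by `ω`: it is irreducible (so `f` vanishes at the origin) and invariant, `ω ∧ df = f η`. -/
def IsFormalSeparatrix (ω : Form 2) (f : MvPowerSeries (Fin 2) ℂ) : Prop :=
  Irreducible f ∧
    f ∣ (ω 0 : MvPowerSeries (Fin 2) ℂ) * MvPowerSeries.pderiv ℂ 1 f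
      - (ω 1 : MvPowerSeries (Fin 2) ℂ) * MvPowerSeries.pderiv ℂ 0 f

/-- The formal curve `f = 0` is divergent: it has no convergent equation. -/
def IsDivergentCurve (f : MvPowerSeries (Fin 2) ℂ) : Prop :=
  ∀ u : MvPowerSeries (Fin 2) ℂ, IsUnit u → ¬ IsConvergent (u * f)

/-! ### Reduction of singularities and foliations of second type -/

/-- The origin is a singular point. -/
def IsSingular (ω : Form 2) : Prop := ∀ i, eval 0 (ω i) = 0

/-- The linear part at the origin of the vector field `ω 1 ∂/∂x - ω 0 ∂/∂y`. -/
def linearPart (ω : Form 2) : Matrix (Fin 2) (Fin 2) ℂ :=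
  Matrix.of fun i j => eval 0 (pderiv j ((![ω 1, -ω 0] : Fin 2 → MvPolynomial (Fin 2) ℂ) i))

/-- One eigenvalue is zero and the other one is not. -/
def IsSaddleNode (ω : Form 2) : Prop :=
  IsSingular ω ∧ ∃ a : ℂ, a ≠ 0 ∧
    (linearPart ω).charpoly = Polynomial.X * (Polynomial.X - Polynomial.C a)

/-- Both eigenvalues are nonzero and their quotient is not a positive rational number. -/
def IsHyperbolic (ω : Form 2) : Prop :=
  IsSingular ω ∧ ∃ a b : ℂ, a ≠ 0 ∧ b ≠ 0 ∧ (∀ q : ℚ, 0 < q → a / b ≠ (q : ℂ)) ∧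
    (linearPart ω).charpoly =
      (Polynomial.X - Polynomial.C a) * (Polynomial.X - Polynomial.C b)

/-- The singular point does not need any further blow-up. -/
def IsReduced (ω : Form 2) : Prop := IsSaddleNode ω ∨ IsHyperbolic ω

/-- `f = 0` is the weak separatrix of a saddle-node: the smooth formal separatrix tangent to the
eigendirection of the zero eigenvalue. -/
def IsWeakSeparatrix (ω : Form 2) (f : MvPowerSeries (Fin 2) ℂ) : Prop :=
  IsFormalSeparatrix ω f ∧ f.order = 1 ∧
    ∀ w : Fin 2 → ℂ, (linearPart ω).mulVec w = 0 →
      ∑ i, MvPowerSeries.coeff (Finsupp.single i 1) f * w i = 0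

/-- A point of a blown-up surface, in coordinates centred at it: the 1-form of the transformed
foliation and the set of those `i` for which the axis `X_i = 0` is a local component of the
exceptional divisor. In the coordinates used here every component of the exceptional divisor
through the point is one of the two axes. -/
structure InfNearPoint where
  form : Form 2
  divisor : Set (Fin 2)

/-- `η` is the strict transform of `ω` by the blow-up chart `T` with exceptional divisor
`X_e = 0`: the pull-back divided by the largest possible power of `X_e`. -/
def IsStrictTransform (T : Fin 2 → MvPolynomial (Fin 2) ℂ) (e : Fin 2) (ω η : Form 2) : Prop :=
  ∃ k : ℕ, (pullback T ω = fun i => X e ^ k * η i) ∧ ¬ ∀ i, X e ∣ η i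

/-- `t` is a point on the exceptional curve of the blow-up of the origin of `s`: either the point
`u = 0`, `v = 0` of the chart `(x, y) = (u, u (v + c))`, or the origin of the chart
`(x, y) = (u v, v)`. -/
def IsBlowUpPoint (s t : InfNearPoint) : Prop :=
  (∃ c : ℂ, IsStrictTransform ![X 0, X 0 * (X 1 + C c)] 0 s.form t.form ∧
      t.divisor = {i | i = 0 ∨ (i = 1 ∧ c = 0 ∧ (1 : Fin 2) ∈ s.divisor)}) ∨
  (IsStrictTransform ![X 0 * X 1, X 1] 1 s.form t.form ∧
      t.divisor = {i | i = 1 ∨ (i = 0 ∧ (0 : Fin 2) ∈ s.divisor)})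

/-- The points that appear in the reduction of singularities of the foliation defined by `ω` near
the origin: one starts with the origin and an empty divisor, and repeatedly blows up the singular
points that are not reduced. -/
inductive InReduction (ω : Form 2) : InfNearPoint → Prop
  | base : InReduction ω ⟨ω, ∅⟩
  | step {s t : InfNearPoint} : InReduction ω s → IsSingular s.form → ¬ IsReduced s.form →
      IsBlowUpPoint s t → InReduction ω t

/-- Second type at the origin: no saddle-node of the reduction process has its weak separatrix
contained in a component of the exceptional divisor. -/
def IsSecondTypeAt (ω : Form 2) : Prop :=
  ∀ s, InReduction ω s → IsSaddleNode s.form →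
    ∀ i ∈ s.divisor, ¬ IsWeakSeparatrix s.form (MvPowerSeries.X i)

/-- The foliation on the projective plane defined by `ω` is of second type. -/
def IsSecondType (ω : Form 3) : Prop :=
  ∀ (i : Fin 3) (v : Fin 3 → ℂ), v i = 1 → (∀ j, eval v (ω j) = 0) →
    IsSecondTypeAt (localForm ω i v)

/-! ### The explicit foliations and maps -/

/-- The projectivisation of Euler's foliation `y² dz + (z - y) dy`, namely
`-(y² z + x y (z - y)) dx + x² (z - y) dy + x y² dz`. -/
def eulerForm : Form 3 :=
  ![-(X 1 ^ 2 * X 2 + X 0 * X 1 * (X 2 - X 1)), X 0 ^ 2 * (X 2 - X 1), X 0 * X 1 ^ 2]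

/-- The linear change of variables `z → z - x`. -/
def shift₁ : Fin 3 → MvPolynomial (Fin 3) ℂ := ![X 0, X 1, X 2 - X 0]

/-- The Cremona map `(x : y : z) ↦ (xy : y² : x² - yz)`. -/
def rho₁ : Fin 3 → MvPolynomial (Fin 3) ℂ := ![X 0 * X 1, X 1 ^ 2, X 0 ^ 2 - X 1 * X 2]

/-- The linear change of variables `y → y - z`. -/
def shift₂ : Fin 3 → MvPolynomial (Fin 3) ℂ := ![X 0, X 1 - X 2, X 2]

/-- The Cremona map `(x : y : z) ↦ (x² : xy : y² - xz)`, which is `rho₁` with the roles of `x`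
and `y` exchanged. -/
def rho₂ : Fin 3 → MvPolynomial (Fin 3) ℂ := ![X 0 ^ 2, X 0 * X 1, X 1 ^ 2 - X 0 * X 2]

/-- The explicit 1-form, with coefficients of degree 8, that is the outcome. -/
def omegaTilde : Form 3 :=
  let x : MvPolynomial (Fin 3) ℂ := X 0
  let y : MvPolynomial (Fin 3) ℂ := X 1
  let z : MvPolynomial (Fin 3) ℂ := X 2
  ![-(x ^ 7 * y) - x ^ 7 * z + 4 * x ^ 6 * y ^ 2 + 4 * x ^ 6 * y * z +
      2 * x ^ 6 * z ^ 2 - 5 * x ^ 5 * y ^ 3 - 4 * x ^ 5 * y ^ 2 * z +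
      x ^ 5 * y * z ^ 2 + x ^ 4 * y ^ 4 - 4 * x ^ 4 * y ^ 3 * z -
      3 * x ^ 4 * y ^ 2 * z ^ 2 - 3 * x ^ 4 * y * z ^ 3 - x ^ 4 * z ^ 4 +
      4 * x ^ 3 * y ^ 5 + 9 * x ^ 3 * y ^ 4 * z + 12 * x ^ 3 * y ^ 3 * z ^ 2 +
      5 * x ^ 3 * y ^ 2 * z ^ 3 - 6 * x ^ 2 * y ^ 6 - 15 * x ^ 2 * y ^ 5 * z -
      9 * x ^ 2 * y ^ 4 * z ^ 2 + 6 * x * y ^ 7 + 7 * x * y ^ 6 * z -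
      2 * y ^ 8,
    x ^ 8 - 4 * x ^ 7 * y - 2 * x ^ 7 * z + 5 * x ^ 6 * y ^ 2 +
      3 * x ^ 6 * y * z - x ^ 5 * y ^ 3 + 2 * x ^ 5 * y ^ 2 * z -
      4 * x ^ 4 * y ^ 4 - 6 * x ^ 4 * y ^ 3 * z - 6 * x ^ 4 * y ^ 2 * z ^ 2 -
      2 * x ^ 4 * y * z ^ 3 + 6 * x ^ 3 * y ^ 5 + 12 * x ^ 3 * y ^ 4 * z +
      6 * x ^ 3 * y ^ 3 * z ^ 2 - 6 * x ^ 2 * y ^ 6 - 6 * x ^ 2 * y ^ 5 * z +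
      2 * x * y ^ 7,
    x ^ 8 - 2 * x ^ 7 * y - 2 * x ^ 7 * z + x ^ 6 * y ^ 2 -
      x ^ 6 * y * z + 2 * x ^ 5 * y ^ 3 + 3 * x ^ 5 * y ^ 2 * z +
      3 * x ^ 5 * y * z ^ 2 + x ^ 5 * z ^ 3 - 3 * x ^ 4 * y ^ 4 -
      6 * x ^ 4 * y ^ 3 * z - 3 * x ^ 4 * y ^ 2 * z ^ 2 + 3 * x ^ 3 * y ^ 5 +
      3 * x ^ 3 * y ^ 4 * z - x ^ 2 * y ^ 6]

end PlaneFoliation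

end

/-! ### Explicit forms: structure, singular locus, chain of transformations, multiplicity. -/

noncomputable section

namespace PlaneFoliation

open MvPolynomial

/-! ### Polynomial forms without common factor -/

/-! Let g be `conic` and c be `sextic`. By `omegaTilde_eq` the form is c (x dg - 2g dx) - x g³ (x dy
- y dx), that is, x³ (c d(g/x²) - g³ d(y/x)). Almost everything follows from this shape. The chain
of maps itself is checked by polynomial identities with explicit intermediate forms.

Singular points: off x = 0 the last coefficient forces c = 0, the second then forces g = 0, and c
reduces to x⁶, a contradiction; on x = 0 the first coefficient is -2y⁸. The same relations exclude
common factors, and they act as Euclid's algorithm for intersection numbers, which gives the Milnor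
number (`colength_mul`, `colength_x`).

Second type: three blow-ups lead to a node with a Jordan block. Blowing it up produces a saddle-node
whose weak separatrix is the new exceptional curve (`isWeakSeparatrix_blowUp₄`).

Separatrix: the chain pulls Euler's affine coordinate y back to t = g/x². With s = ty/x, invariance
becomes the linear equation `slope_ode`, solved by s = 1 - t + t³E, where E = ∑ (-1)ⁿ (n + 1)! tⁿ.
Expressing x and y through t gives a smooth formal curve x = h(y). If some equation of it converged,
the implicit function theorem for power series (`isConvergentOne_of_subst_eq_zero`), applied three
times, would make h, then y(t), then E converge; but E diverges. -/

/-- A prime dividing a variable is associated to it. A common factor of this kind is therefore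
refuted by one point of the coordinate hyperplane where some coefficient is nonzero. -/
theorem eval_eq_zero_of_prime_dvd {n : ℕ} {π f : MvPolynomial (Fin n) ℂ} {i : Fin n}
    (hπ : Prime π) (hi : π ∣ X i) (hf : π ∣ f) {v : Fin n → ℂ} (hv : v i = 0) : eval v f = 0 := by
  have h : X i ∣ f :=
    ((hπ.irreducible.dvd_irreducible_iff_associated X_prime.irreducible).1 hi).symm.dvd.trans hf
  obtain ⟨k, rfl⟩ := h
  simp [hv]

theorem isUnit_of_dvd_form {n : ℕ} {ω : Form n} (h0 : ω ≠ 0)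
    (h : ∀ π, Prime π → ¬ ∀ i, π ∣ ω i) {g : MvPolynomial (Fin n) ℂ} (hg : ∀ i, g ∣ ω i) :
    IsUnit g := by
  by_contra hu
  have hg0 : g ≠ 0 := by
    rintro rfl
    exact h0 (funext fun i => by simpa using hg i)
  obtain ⟨π, hπ, hd⟩ := WfDvdMonoid.exists_irreducible_factor hu hg0
  exact h π hπ.prime fun i => hd.trans (hg i)

/-! ### The structure of the transformed form -/

/-- The equation `xz - y² + xy` of the conic that carries the cubed factor of `omegaTilde`. -/
def conic : MvPolynomial (Fin 3) ℂ := X 0 * X 2 - X 1 ^ 2 + X 0 * X 1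

/-- The sextic `C / x²`, where `C` is the last coefficient of `omegaTilde`. -/
def sextic : MvPolynomial (Fin 3) ℂ :=
  conic ^ 3 - X 0 ^ 3 * (2 * X 0 + X 1) * conic + X 0 ^ 6

/-- The cofactors of `sextic` are the coefficients of x dg - 2g dx = x³ d(g/x²); the terms with
`conic ^ 3` are those of -x³ g³ d(y/x). -/
theorem omegaTilde_eq : omegaTilde =
    ![sextic * (2 * X 1 ^ 2 - X 0 * X 2 - X 0 * X 1) + X 0 * X 1 * conic ^ 3,
      X 0 * (sextic * (X 0 - 2 * X 1) - X 0 * conic ^ 3),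
      X 0 ^ 2 * sextic] := by
  funext i
  fin_cases i <;> simp [omegaTilde, sextic, conic] <;> ring

theorem isHomogeneous_conic : conic.IsHomogeneous 2 :=
  (((isHomogeneous_X ℂ _).mul (isHomogeneous_X ℂ _)).sub ((isHomogeneous_X ℂ _).pow 2)).add
    ((isHomogeneous_X ℂ _).mul (isHomogeneous_X ℂ _))

theorem isHomogeneous_two_mul {n d : ℕ} {f : MvPolynomial (Fin n) ℂ} (hf : f.IsHomogeneous d) :
    (2 * f).IsHomogeneous d := by
  rw [two_mul]
  exact hf.add hf

theorem isHomogeneous_sextic : sextic.IsHomogeneous 6 :=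
  ((isHomogeneous_conic.pow 3).sub ((((isHomogeneous_X ℂ _).pow 3).mul
    ((isHomogeneous_two_mul (isHomogeneous_X ℂ _)).add (isHomogeneous_X ℂ _))).mul
      isHomogeneous_conic)).add ((isHomogeneous_X ℂ _).pow 6)

theorem isFoliation_omegaTilde : IsFoliation 7 omegaTilde := by
  rw [omegaTilde_eq]
  have hX : ∀ i : Fin 3, (X i : MvPolynomial (Fin 3) ℂ).IsHomogeneous 1 := isHomogeneous_X ℂ
  refine ⟨fun i => ?_, ?_, fun g hg => isUnit_of_dvd_form (fun h => ?_) (fun π hπ hd => ?_) hg⟩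
  · fin_cases i
    · exact (isHomogeneous_sextic.mul (((isHomogeneous_two_mul ((hX 1).pow 2)).sub
        ((hX 0).mul (hX 2))).sub ((hX 0).mul (hX 1)))).add
          (((hX 0).mul (hX 1)).mul (isHomogeneous_conic.pow 3))
    · exact (hX 0).mul ((isHomogeneous_sextic.mul ((hX 0).sub (isHomogeneous_two_mul (hX 1)))).sub
        ((hX 0).mul (isHomogeneous_conic.pow 3)))
    · exact ((hX 0).pow 2).mul isHomogeneous_sextic
  · simp [Fin.sum_univ_three, conic]
    ring
  · have := congrArg (eval ![0, 1, 0]) (congrFun h 0)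
    simp [conic, sextic] at this
  · have h0 := hd 0
    have h1 := hd 1
    have h2 := hd 2
    simp only [Matrix.cons_val] at h0 h1 h2
    -- If π divides the sextic, the second coefficient gives π ∣ x² g³, and π ∣ g in turn gives π ∣
    -- x⁶: every branch ends at x. But the first coefficient is -2 at (0, 1, 0).
    have hx : π ∣ X 0 := by
      rcases hπ.dvd_or_dvd h2 with h | h
      · exact hπ.dvd_of_dvd_pow h
      · have h3 : π ∣ X 0 ^ 2 * conic ^ 3 := by
          convert (h.mul_right (X 0 * (X 0 - 2 * X 1))).sub h1 using 1
          ring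
        rcases hπ.dvd_or_dvd h3 with h | h'
        · exact hπ.dvd_of_dvd_pow h
        · have h4 := hπ.dvd_of_dvd_pow h'
          refine hπ.dvd_of_dvd_pow (n := 6) ?_
          convert h.sub (h4.mul_right (conic ^ 2 - X 0 ^ 3 * (2 * X 0 + X 1))) using 1
          rw [sextic]
          ring
    have := eval_eq_zero_of_prime_dvd hπ hx h0 (v := ![0, 1, 0]) (by simp)
    simp [conic, sextic] at this

theorem isInvariantPlaneCurve_omegaTilde : IsInvariantPlaneCurve omegaTilde (X 0) := by
  rw [omegaTilde_eq]
  intro i j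
  fin_cases i <;> fin_cases j <;>
    simp [pderiv_X, pow_two, mul_assoc]

theorem eval_omegaTilde_eq_zero_iff (v : Fin 3 → ℂ) :
    (∀ i, eval v (omegaTilde i) = 0) ↔ v 0 = 0 ∧ v 1 = 0 := by
  rw [omegaTilde_eq]
  simp only [Fin.forall_fin_succ, conic, sextic]
  simp
  set g := v 0 * v 2 - v 1 ^ 2 + v 0 * v 1 with hg
  clear_value g
  constructor
  · rintro ⟨h0, h1, h2⟩
    have hx : v 0 = 0 := by
      by_contra hx
      have hc : g ^ 3 - v 0 ^ 3 * (2 * v 0 + v 1) * g + v 0 ^ 6 = 0 := by simpa [hx] using h2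
      rw [hc] at h1
      have hg0 : g = 0 := by simpa [hx] using h1
      rw [hg0] at hc
      simp [hx] at hc
    refine ⟨hx, ?_⟩
    rw [hx] at h0 hg
    rw [hg] at h0
    simpa using h0
  · rintro ⟨hx, hy⟩
    rw [hx, hy] at hg ⊢
    simp

theorem singularSet_omegaTilde : singularSet omegaTilde =
    {Projectivization.mk ℂ ![0, 0, 1] (fun h => one_ne_zero (congrFun h 2))} := by
  ext p
  simp only [singularSet, Set.mem_ofPred_eq, eval_omegaTilde_eq_zero_iff, Set.mem_singleton_iff]
  conv_rhs => rw [← Projectivization.mk_rep p, Projectivization.mk_eq_mk_iff']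
  constructor
  · rintro ⟨h0, h1⟩
    refine ⟨p.rep 2, funext fun i => ?_⟩
    fin_cases i <;> simp [h0, h1]
  · rintro ⟨a, ha⟩
    rw [← ha]
    simp

/-! ### The chain of transformations -/

theorem isFoliation_eulerForm : IsFoliation 2 eulerForm := by
  have hX : ∀ i : Fin 3, (X i : MvPolynomial (Fin 3) ℂ).IsHomogeneous 1 := isHomogeneous_X ℂ
  refine ⟨fun i => ?_, ?_, fun g hg => isUnit_of_dvd_form (fun h => ?_) (fun π hπ hd => ?_) hg⟩
  · fin_cases i
    · exact ((((hX 1).pow 2).mul (hX 2)).add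
        (((hX 0).mul (hX 1)).mul ((hX 2).sub (hX 1)))).neg
    · exact ((hX 0).pow 2).mul ((hX 2).sub (hX 1))
    · exact (hX 0).mul ((hX 1).pow 2)
  · simp [Fin.sum_univ_three, eulerForm]
    ring
  · have := congrArg (eval ![0, 1, 1]) (congrFun h 0)
    simp [eulerForm] at this
  · have h0 := hd 0
    have h1 := hd 1
    have h2 := hd 2
    simp only [eulerForm, Matrix.cons_val] at h0 h1 h2
    rcases hπ.dvd_or_dvd h2 with h | h
    · have := eval_eq_zero_of_prime_dvd hπ h h0 (v := ![0, 1, 1]) (by simp)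
      simp at this
    · have := eval_eq_zero_of_prime_dvd hπ (hπ.dvd_of_dvd_pow h) h1 (v := ![1, 0, 1]) (by simp)
      simp at this

theorem localForm_zero (ω : Form 3) :
    localForm ω 0 ![1, 0, 0] = fun j => bind₁ ![1, X 0, X 1] (ω j.succ) := by
  have h : (Fin.insertNth 0 1 fun k => X k + C (![1, 0, 0] ((0 : Fin 3).succAbove k)) :
      Fin 3 → MvPolynomial (Fin 2) ℂ) = ![1, X 0, X 1] := by
    funext i
    fin_cases i
    · rfl
    · change X 0 + C 0 = X 0
      simp
    · change X 1 + C 0 = X 1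
      simp
  funext j
  exact congrArg (fun T => bind₁ T (ω j.succ)) h

theorem localForm_two (ω : Form 3) :
    localForm ω 2 ![0, 0, 1] = fun j => bind₁ ![X 0, X 1, 1] (ω j.castSucc) := by
  have h : (Fin.insertNth 2 1 fun k => X k + C (![0, 0, 1] ((2 : Fin 3).succAbove k)) :
      Fin 3 → MvPolynomial (Fin 2) ℂ) = ![X 0, X 1, 1] := by
    funext i
    fin_cases i
    · change X 0 + C 0 = X 0
      simp
    · change X 1 + C 0 = X 1
      simp
    · rfl
  funext j
  have h2 : (2 : Fin 3).succAbove j = j.castSucc := by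
    fin_cases j <;> rfl
  rw [← h2]
  exact congrArg (fun T => bind₁ T (ω ((2 : Fin 3).succAbove j))) h

theorem localForm_eulerForm : localForm eulerForm 0 ![1, 0, 0] = ![X 1 - X 0, X 0 ^ 2] := by
  rw [localForm_zero]
  funext i
  fin_cases i <;> simp [eulerForm]

/-- The pull-back of `eulerForm` by `shift₁`. -/
def omega₁ : Form 3 :=
  ![X 0 ^ 2 * X 1 + X 0 * X 1 ^ 2 - X 0 * X 1 * X 2 - X 1 ^ 2 * X 2,
    X 0 ^ 2 * (X 2 - X 0 - X 1), X 0 * X 1 ^ 2]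

/-- The pull-back of `omega₁` by `rho₁`, divided by `y³`. -/
def omega₂ : Form 3 :=
  ![X 1 * (2 * (X 0 ^ 2 * X 1) - X 0 ^ 3 + X 0 * X 1 ^ 2 + X 0 * X 1 * X 2 + X 1 ^ 2 * X 2),
    X 0 ^ 2 * (X 0 ^ 2 - 2 * (X 0 * X 1) - X 1 ^ 2 - X 1 * X 2), -(X 0 * X 1 ^ 3)]

/-- The pull-back of `omega₂` by `shift₂`. -/
def omega₃ : Form 3 :=
  ![(X 1 - X 2) * (2 * (X 0 ^ 2 * (X 1 - X 2)) - X 0 ^ 3 + X 0 * (X 1 - X 2) ^ 2 +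
      X 0 * (X 1 - X 2) * X 2 + (X 1 - X 2) ^ 2 * X 2),
    X 0 ^ 2 * (X 0 ^ 2 - 2 * (X 0 * (X 1 - X 2)) - (X 1 - X 2) ^ 2 - (X 1 - X 2) * X 2),
    -(X 0 * (X 1 - X 2) ^ 3) -
      X 0 ^ 2 * (X 0 ^ 2 - 2 * (X 0 * (X 1 - X 2)) - (X 1 - X 2) ^ 2 - (X 1 - X 2) * X 2)]

theorem isFoliation_omega₁ : IsFoliation 2 omega₁ := by
  have hX : ∀ i : Fin 3, (X i : MvPolynomial (Fin 3) ℂ).IsHomogeneous 1 := isHomogeneous_X ℂ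
  refine ⟨fun i => ?_, ?_, fun g hg => isUnit_of_dvd_form (fun h => ?_) (fun π hπ hd => ?_) hg⟩
  · fin_cases i
    · exact (((((hX 0).pow 2).mul (hX 1)).add ((hX 0).mul ((hX 1).pow 2))).sub
        (((hX 0).mul (hX 1)).mul (hX 2))).sub (((hX 1).pow 2).mul (hX 2))
    · exact ((hX 0).pow 2).mul (((hX 2).sub (hX 0)).sub (hX 1))
    · exact (hX 0).mul ((hX 1).pow 2)
  · simp [Fin.sum_univ_three, omega₁]
    ring
  · have := congrArg (eval ![0, 1, 1]) (congrFun h 0)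
    simp [omega₁] at this
  · have h0 := hd 0
    have h1 := hd 1
    have h2 := hd 2
    simp only [omega₁, Matrix.cons_val] at h0 h1 h2
    rcases hπ.dvd_or_dvd h2 with h | h
    · have := eval_eq_zero_of_prime_dvd hπ h h0 (v := ![0, 1, 1]) (by simp)
      simp at this
    · have := eval_eq_zero_of_prime_dvd hπ (hπ.dvd_of_dvd_pow h) h1 (v := ![1, 0, 0]) (by simp)
      simp at this

theorem isFoliation_omega₂ : IsFoliation 3 omega₂ := by
  have hX : ∀ i : Fin 3, (X i : MvPolynomial (Fin 3) ℂ).IsHomogeneous 1 := isHomogeneous_X ℂ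
  refine ⟨fun i => ?_, ?_, fun g hg => isUnit_of_dvd_form (fun h => ?_) (fun π hπ hd => ?_) hg⟩
  · fin_cases i
    · exact (hX 1).mul (((((isHomogeneous_two_mul (((hX 0).pow 2).mul (hX 1))).sub
        ((hX 0).pow 3)).add ((hX 0).mul ((hX 1).pow 2))).add
          (((hX 0).mul (hX 1)).mul (hX 2))).add (((hX 1).pow 2).mul (hX 2)))
    · exact ((hX 0).pow 2).mul (((((hX 0).pow 2).sub
        (isHomogeneous_two_mul ((hX 0).mul (hX 1)))).sub ((hX 1).pow 2)).sub ((hX 1).mul (hX 2)))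
    · exact ((hX 0).mul ((hX 1).pow 3)).neg
  · simp [Fin.sum_univ_three, omega₂]
    ring
  · have := congrArg (eval ![0, 1, 1]) (congrFun h 0)
    simp [omega₂] at this
  · have h0 := hd 0
    have h1 := hd 1
    have h2 := hd 2
    simp only [omega₂, Matrix.cons_val, dvd_neg] at h0 h1 h2
    rcases hπ.dvd_or_dvd h2 with h | h
    · have := eval_eq_zero_of_prime_dvd hπ h h0 (v := ![0, 1, 1]) (by simp)
      simp at this
    · have := eval_eq_zero_of_prime_dvd hπ (hπ.dvd_of_dvd_pow h) h1 (v := ![1, 0, 0]) (by simp)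
      simp at this

theorem isFoliation_omega₃ : IsFoliation 3 omega₃ := by
  have hX : ∀ i : Fin 3, (X i : MvPolynomial (Fin 3) ℂ).IsHomogeneous 1 := isHomogeneous_X ℂ
  have hY : (X 1 - X 2 : MvPolynomial (Fin 3) ℂ).IsHomogeneous 1 := (hX 1).sub (hX 2)
  have hB : (X 0 ^ 2 * (X 0 ^ 2 - 2 * (X 0 * (X 1 - X 2)) - (X 1 - X 2) ^ 2 -
      (X 1 - X 2) * X 2) : MvPolynomial (Fin 3) ℂ).IsHomogeneous 4 :=
    ((hX 0).pow 2).mul (((((hX 0).pow 2).sub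
      (isHomogeneous_two_mul ((hX 0).mul hY))).sub (hY.pow 2)).sub (hY.mul (hX 2)))
  refine ⟨fun i => ?_, ?_, fun g hg => isUnit_of_dvd_form (fun h => ?_) (fun π hπ hd => ?_) hg⟩
  · fin_cases i
    · exact hY.mul (((((isHomogeneous_two_mul (((hX 0).pow 2).mul hY)).sub
        ((hX 0).pow 3)).add ((hX 0).mul (hY.pow 2))).add
          (((hX 0).mul hY).mul (hX 2))).add ((hY.pow 2).mul (hX 2)))
    · exact hB
    · exact (((hX 0).mul (hY.pow 3)).neg).sub hB
  · simp [Fin.sum_univ_three, omega₃]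
    ring
  · have := congrArg (eval ![0, 0, 1]) (congrFun h 0)
    simp [omega₃] at this
  · have h0 := hd 0
    have h1 := hd 1
    have h2 := hd 2
    simp only [omega₃, Matrix.cons_val] at h0 h1 h2
    -- The last two coefficients add up to -x(y - z)³, and modulo y - z the second one is x⁴.
    have h3 : π ∣ X 0 * (X 1 - X 2) ^ 3 := by
      convert (h1.add h2).neg_right using 1
      ring
    have hx : π ∣ X 0 := by
      rcases hπ.dvd_or_dvd h3 with h | h
      · exact h
      · refine hπ.dvd_of_dvd_pow (n := 4) ?_
        convert h1.add ((hπ.dvd_of_dvd_pow h).mul_right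
          (X 0 ^ 2 * (2 * X 0 + (X 1 - X 2) + X 2))) using 1
        ring
    have := eval_eq_zero_of_prime_dvd hπ hx h0 (v := ![0, 0, 1]) (by simp)
    simp at this

theorem isTransform_shift₁ : IsTransform shift₁ eulerForm omega₁ := by
  refine ⟨⟨2, isFoliation_omega₁⟩, 1, one_ne_zero, funext fun i => ?_⟩
  fin_cases i <;>
    (simp [pullback, shift₁, eulerForm, omega₁, Fin.sum_univ_three, pderiv_X]; try ring)

theorem isTransform_rho₁ : IsTransform rho₁ omega₁ omega₂ := by
  refine ⟨⟨3, isFoliation_omega₂⟩, X 1 ^ 3, pow_ne_zero _ (X_ne_zero _), funext fun i => ?_⟩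
  fin_cases i <;>
    simp [pullback, rho₁, omega₁, omega₂, Fin.sum_univ_three, pderiv_X] <;>
    ring

theorem isTransform_shift₂ : IsTransform shift₂ omega₂ omega₃ := by
  refine ⟨⟨3, isFoliation_omega₃⟩, 1, one_ne_zero, funext fun i => ?_⟩
  fin_cases i <;>
    (simp [pullback, shift₂, omega₂, omega₃, Fin.sum_univ_three, pderiv_X, map_ofNat]; try ring)

theorem isTransform_rho₂ : IsTransform rho₂ omega₃ omegaTilde := by
  refine ⟨⟨7, isFoliation_omegaTilde⟩, X 0, X_ne_zero _, funext fun i => ?_⟩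
  fin_cases i <;>
    simp [pullback, rho₂, omega₃, omegaTilde, Fin.sum_univ_three, pderiv_X,
      map_ofNat] <;>
    ring

/-! ### The singular point `(0 : 0 : 1)` -/

/-- The conic `xz - y² + xy` in the chart `z = 1`. -/
def conicGerm : MvPolynomial (Fin 2) ℂ := X 0 - X 1 ^ 2 + X 0 * X 1

/-- The sextic in the chart `z = 1`. -/
def sexticGerm : MvPolynomial (Fin 2) ℂ :=
  conicGerm ^ 3 - X 0 ^ 3 * (2 * X 0 + X 1) * conicGerm + X 0 ^ 6

/-- The form `omegaTilde` in the chart `z = 1`. -/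
def omegaLocal : Form 2 :=
  ![sexticGerm * (2 * X 1 ^ 2 - X 0 - X 0 * X 1) + X 0 * X 1 * conicGerm ^ 3,
    X 0 * (sexticGerm * (X 0 - 2 * X 1) - X 0 * conicGerm ^ 3)]

theorem localForm_omegaTilde : localForm omegaTilde 2 ![0, 0, 1] = omegaLocal := by
  rw [localForm_two, omegaTilde_eq]
  funext i
  fin_cases i <;> simp [omegaLocal, conicGerm, sexticGerm, conic, sextic, map_ofNat]

theorem constantCoeff_coe (p : MvPolynomial (Fin 2) ℂ) :
    MvPowerSeries.constantCoeff (p : MvPowerSeries (Fin 2) ℂ) = eval 0 p := by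
  rw [← MvPowerSeries.coeff_zero_eq_constantCoeff_apply, MvPolynomial.coeff_coe, eval_zero,
    constantCoeff_eq]

theorem one_le_order_coe {p : MvPolynomial (Fin 2) ℂ} (h : eval 0 p = 0) :
    1 ≤ (p : MvPowerSeries (Fin 2) ℂ).order := by
  rw [MvPowerSeries.one_le_order_iff_constCoeff_eq_zero, constantCoeff_coe, h]

theorem le_order_coe_mul {m n : ℕ} {p q : MvPolynomial (Fin 2) ℂ}
    (hp : (m : ℕ∞) ≤ (p : MvPowerSeries (Fin 2) ℂ).order)
    (hq : (n : ℕ∞) ≤ (q : MvPowerSeries (Fin 2) ℂ).order) :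
    ((m + n : ℕ) : ℕ∞) ≤ ((p * q : MvPolynomial (Fin 2) ℂ) : MvPowerSeries (Fin 2) ℂ).order := by
  push_cast
  exact (add_le_add hp hq).trans MvPowerSeries.le_order_mul

theorem le_order_coe_add {n : ℕ∞} {p q : MvPolynomial (Fin 2) ℂ}
    (hp : n ≤ (p : MvPowerSeries (Fin 2) ℂ).order)
    (hq : n ≤ (q : MvPowerSeries (Fin 2) ℂ).order) :
    n ≤ ((p + q : MvPolynomial (Fin 2) ℂ) : MvPowerSeries (Fin 2) ℂ).order := by
  push_cast
  exact (le_min hp hq).trans MvPowerSeries.min_order_le_add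

theorem multiplicity_omegaLocal : multiplicity omegaLocal = 4 := by
  have ho : ∀ {p : MvPolynomial (Fin 2) ℂ}, eval 0 p = 0 →
      ((1 : ℕ) : ℕ∞) ≤ (p : MvPowerSeries (Fin 2) ℂ).order := fun h => by
    exact_mod_cast one_le_order_coe h
  have hx := ho (p := X 0) (by simp)
  have hg := ho (p := conicGerm) (by simp [conicGerm])
  have hg3 : ((3 : ℕ) : ℕ∞) ≤ ((conicGerm ^ 3 : MvPolynomial (Fin 2) ℂ) :
      MvPowerSeries (Fin 2) ℂ).order := by
    convert le_order_coe_mul (le_order_coe_mul hg hg) hg using 3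
    ring
  have hs : ((3 : ℕ) : ℕ∞) ≤ (sexticGerm : MvPowerSeries (Fin 2) ℂ).order := by
    have h1 := le_order_coe_mul (le_order_coe_mul hx hx) (le_order_coe_mul hx
      (ho (p := X 0 ^ 3 - (2 * X 0 + X 1) * conicGerm) (by simp)))
    have h2 := le_order_coe_add hg3 ((Nat.cast_le.2 (by norm_num : 3 ≤ 4)).trans h1)
    convert h2 using 3
    rw [sexticGerm]
    ring
  have hp : ((4 : ℕ) : ℕ∞) ≤ ((omegaLocal 0 : MvPolynomial (Fin 2) ℂ) :
      MvPowerSeries (Fin 2) ℂ).order :=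
    le_order_coe_add (le_order_coe_mul hs (ho (by simp)))
      (le_order_coe_mul (m := 1) (n := 3)
        (ho (p := X 0 * X 1) (by simp)) hg3)
  have hq : ((4 : ℕ) : ℕ∞) ≤ ((omegaLocal 1 : MvPolynomial (Fin 2) ℂ) :
      MvPowerSeries (Fin 2) ℂ).order := by
    have h1 := le_order_coe_mul hx (le_order_coe_add
      ((Nat.cast_le.2 (by norm_num : 3 ≤ 3 + 1)).trans
        (le_order_coe_mul hs (ho (p := X 0 - 2 * X 1) (by simp))))
      ((Nat.cast_le.2 (by norm_num : 3 ≤ 1 + 3)).trans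
        (le_order_coe_mul (ho (p := -X 0) (by simp)) hg3)))
    convert h1 using 3
    simp only [omegaLocal, Matrix.cons_val]
    ring
  have hp' : ((omegaLocal 0 : MvPolynomial (Fin 2) ℂ) : MvPowerSeries (Fin 2) ℂ).order ≤ 4 := by
    -- Modulo y the conic is x and the first coefficient is -x⁴ + 2x⁶ - x⁷, so x⁴ occurs with
    -- coefficient -1.
    have hc : MvPowerSeries.coeff (Finsupp.single 0 4)
        ((omegaLocal 0 : MvPolynomial (Fin 2) ℂ) : MvPowerSeries (Fin 2) ℂ) ≠ 0 := by
      have h1 : X 1 ∣ conicGerm - X 0 := ⟨X 0 - X 1, by rw [conicGerm]; ring⟩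
      have h2 : X 1 ∣ conicGerm ^ 3 - X 0 ^ 3 := h1.trans (sub_dvd_pow_sub_pow _ _ 3)
      obtain ⟨a, ha⟩ := h1
      obtain ⟨b, hb⟩ := h2
      have h3 : omegaLocal 0 = X 0 ^ 4 * (-1 + X 0 * (2 * X 0 - X 0 ^ 2)) +
          X 1 * ((2 * X 1 - X 0) * sexticGerm + X 0 * conicGerm ^ 3 -
            X 0 * (b - X 0 ^ 3 * conicGerm - 2 * X 0 ^ 4 * a)) := by
        simp only [omegaLocal, Matrix.cons_val, sexticGerm]
        linear_combination (-X 0) * hb + (2 * X 0 ^ 5) * ha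
      rw [MvPolynomial.coeff_coe, h3, coeff_add, X_pow_eq_monomial (e := 4),
        coeff_monomial_mul', coeff_X_mul']
      simp [← constantCoeff_eq]
    simpa using MvPowerSeries.order_le hc
  refine le_antisymm ((min_le_left _ _).trans hp') (le_min hp hq)

end PlaneFoliation

end

/-! ### Intersection numbers in the ring of convergent series, and the Milnor number. -/

noncomputable section

namespace PlaneFoliation

open MvPolynomial

/-! ### Lengths of quotients by two elements -/

/-- The dimension of `R / (f, g)` over `ℂ`. -/
def colength {R : Type*} [CommRing R] [Algebra ℂ R] (f g : R) : ℕ∞ :=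
  Module.length ℂ (R ⧸ Ideal.span {f, g})

section colength

variable {R : Type*} [CommRing R] [Algebra ℂ R]

theorem colength_comm (f g : R) : colength f g = colength g f := by
  rw [colength, colength, Set.pair_comm]

theorem colength_congr {f g f' g' : R} (h : Ideal.span {f, g} = Ideal.span {f', g'}) :
    colength f g = colength f' g' := by
  rw [colength, colength, h]

/-- One step of Euclid's algorithm: f may be reduced modulo g, and signs do not matter. -/
theorem colength_eq_of_neg_eq_add_mul {f f' g : R} (a : R) (h : -f' = f + a * g) :
    colength f g = colength f' g := by
  refine colength_congr (le_antisymm ?_ ?_) <;>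
    rw [Ideal.span_le, Set.insert_subset_iff, Set.singleton_subset_iff] <;>
    refine ⟨?_, Ideal.subset_span (by simp)⟩ <;> rw [SetLike.mem_coe, Ideal.mem_span_pair]
  all_goals exact ⟨-1, -a, by linear_combination h⟩

/-- Additivity of intersection numbers. -/
theorem colength_mul [IsDomain R] {f g h : R} (hg0 : g ≠ 0) (hg : ∀ a, g ∣ h * a → g ∣ a) :
    colength (g * f) h = colength f h + colength g h := by
  let I : Ideal R := Ideal.span {f, h}
  let J : Ideal R := Ideal.span {g * f, h}
  let K : Ideal R := Ideal.span {g, h}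
  have hIJ : I ≤ Submodule.comap (LinearMap.mulLeft R g) J := by
    rw [Ideal.span_le, Set.insert_subset_iff, Set.singleton_subset_iff]
    exact ⟨Ideal.subset_span (by simp), Ideal.mul_mem_left _ _ (Ideal.subset_span (by simp))⟩
  have hJK : J ≤ Submodule.comap LinearMap.id K := by
    rw [Ideal.span_le, Set.insert_subset_iff, Set.singleton_subset_iff]
    exact ⟨Ideal.mul_mem_right _ _ (Ideal.subset_span (by simp)), Ideal.subset_span (by simp)⟩
  let φ : (R ⧸ I) →ₗ[R] (R ⧸ J) := Submodule.mapQ I J (LinearMap.mulLeft R g) hIJ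
  let ψ : (R ⧸ J) →ₗ[R] (R ⧸ K) := Submodule.mapQ J K LinearMap.id hJK
  -- The sequence 0 → R/(f, h) → R/(gf, h) → R/(g, h) → 0, with multiplication by g on the left, is
  -- exact. Length takes values in `ℕ∞`, so no finiteness has to be known beforehand.
  refine Module.length_eq_add_of_exact (φ.restrictScalars ℂ) (ψ.restrictScalars ℂ) ?_ ?_ ?_
  · rw [← LinearMap.ker_eq_bot]
    rw [LinearMap.ker_eq_bot']
    intro m hm
    obtain ⟨a, rfl⟩ := Submodule.Quotient.mk_surjective _ m
    have h1 : g * a ∈ J := (Submodule.Quotient.mk_eq_zero _).1 hm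
    rw [Submodule.Quotient.mk_eq_zero]
    obtain ⟨x, y, hxy⟩ := Ideal.mem_span_pair.1 h1
    obtain ⟨z, rfl⟩ := hg y ⟨a - x * f, by linear_combination hxy⟩
    refine Ideal.mem_span_pair.2 ⟨x, z, mul_left_cancel₀ hg0 ?_⟩
    linear_combination hxy
  · intro m
    obtain ⟨a, rfl⟩ := Submodule.Quotient.mk_surjective _ m
    exact ⟨Submodule.Quotient.mk a, rfl⟩
  · intro m
    obtain ⟨a, rfl⟩ := Submodule.Quotient.mk_surjective _ m
    constructor
    · intro hm
      have h1 : a ∈ K := (Submodule.Quotient.mk_eq_zero _).1 hm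
      obtain ⟨x, y, hxy⟩ := Ideal.mem_span_pair.1 h1
      refine ⟨Submodule.Quotient.mk x, (Submodule.Quotient.eq _).2 ?_⟩
      refine Ideal.mem_span_pair.2 ⟨0, -y, ?_⟩
      change _ = g * x - a
      linear_combination -hxy
    · rintro ⟨m, hm⟩
      obtain ⟨b, rfl⟩ := Submodule.Quotient.mk_surjective _ m
      rw [← hm]
      exact (Submodule.Quotient.mk_eq_zero _).2 (Ideal.mul_mem_right _ _
        (Ideal.subset_span (by simp)))

theorem colength_pow [IsDomain R] {g h : R} (hg0 : g ≠ 0) (hg : ∀ a, g ∣ h * a → g ∣ a) (n : ℕ) :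
    colength (g ^ n) h = n * colength g h := by
  induction n with
  | zero =>
    have h1 : Ideal.span {g ^ 0, h} = ⊤ := by
      rw [Ideal.eq_top_iff_one]
      exact Ideal.subset_span (by simp)
    rw [colength, h1]
    simp
  | succ n ih =>
    rw [pow_succ', colength_mul hg0 hg, ih]
    push_cast
    ring

end colength

/-! ### The ring of convergent power series -/

/-- The embedding of the second variable. -/
def secondVar : Unit ↪ Fin 2 := ⟨fun _ => 1, fun _ _ _ => rfl⟩

/-- The restriction of a power series to the line `X 0 = 0`. -/
def restrict : MvPowerSeries (Fin 2) ℂ →ₐ[ℂ] PowerSeries ℂ := MvPowerSeries.killCompl secondVar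

theorem coeff_restrict (f : MvPowerSeries (Fin 2) ℂ) (n : ℕ) :
    PowerSeries.coeff n (restrict f) = MvPowerSeries.coeff (Finsupp.single 1 n) f := by
  rw [PowerSeries.coeff, restrict, MvPowerSeries.coeff_killCompl, Finsupp.embDomain_single]
  rfl

theorem restrict_X_zero : restrict (MvPowerSeries.X 0) = 0 :=
  MvPowerSeries.killCompl_X_eq_zero (by
    rintro ⟨_, h⟩
    exact one_ne_zero (show (1 : Fin 2) = 0 from h))

theorem restrict_X_one : restrict (MvPowerSeries.X 1) = PowerSeries.X :=
  MvPowerSeries.killCompl_X ()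

theorem restrict_eq_zero_iff {f : MvPowerSeries (Fin 2) ℂ} :
    restrict f = 0 ↔ MvPowerSeries.X 0 ∣ f := by
  rw [MvPowerSeries.X_dvd_iff]
  constructor
  · intro h m hm
    have : m = Finsupp.single 1 (m 1) := by
      ext i
      fin_cases i <;> simp [hm]
    rw [this, ← coeff_restrict, h, map_zero]
  · intro h
    ext n
    rw [coeff_restrict, h _ (by simp), map_zero]

/-- Shifting the coefficients costs only a constant power of r. Quotients by x or by yⁿ are such
shifts, so they stay convergent. -/
theorem IsConvergent.shift {f : MvPowerSeries (Fin 2) ℂ} (hf : IsConvergent f) (s : Fin 2 →₀ ℕ) :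
    IsConvergent fun n => MvPowerSeries.coeff (n + s) f := by
  obtain ⟨r, hr, h⟩ := hf
  refine ⟨r, hr, ?_⟩
  have h1 := (h.comp_injective (add_left_injective s)).mul_right (r ^ s.degree)⁻¹
  refine h1.congr fun n => ?_
  simp only [Function.comp_apply, map_add, pow_add]
  field_simp
  rfl

namespace ConvergentSeries

instance : IsDomain ConvergentSeries :=
  have : IsDomain (MvPowerSeries (Fin 2) ℂ) := NoZeroDivisors.to_isDomain _
  Function.Injective.isDomain ConvergentSeries.val.toRingHom Subtype.val_injective

/-- The first coordinate. -/
def x : ConvergentSeries := germ (X 0)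

/-- The second coordinate. -/
def y : ConvergentSeries := germ (X 1)

theorem coe_x : (x : MvPowerSeries (Fin 2) ℂ) = MvPowerSeries.X 0 := MvPolynomial.coe_X 0

theorem coe_y : (y : MvPowerSeries (Fin 2) ℂ) = MvPowerSeries.X 1 := MvPolynomial.coe_X 1

theorem x_dvd_iff {f : ConvergentSeries} : x ∣ f ↔ restrict f = 0 := by
  constructor
  · rintro ⟨k, rfl⟩
    rw [MulMemClass.coe_mul, map_mul, coe_x, restrict_X_zero, zero_mul]
  · intro h
    obtain ⟨k, hk⟩ := restrict_eq_zero_iff.1 h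
    have hk' : (fun n => MvPowerSeries.coeff (n + Finsupp.single 0 1) (f : MvPowerSeries _ ℂ)) =
        k := by
      funext n
      rw [hk, MvPowerSeries.X, add_comm, MvPowerSeries.coeff_add_monomial_mul, one_mul]
      rfl
    have hkc : IsConvergent k := by
      rw [← hk']
      exact f.2.shift _
    exact ⟨⟨k, hkc⟩, Subtype.ext (by rw [MulMemClass.coe_mul, coe_x]; exact hk)⟩

theorem prime_x : Prime x := by
  refine ⟨fun h => ?_, fun h => ?_, fun a b h => ?_⟩
  · have h1 := congrArg (Subtype.val) h
    rw [coe_x] at h1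
    have h2 := congrArg (MvPowerSeries.coeff (Finsupp.single 0 1)) h1
    simp at h2
  · have h1 := (x_dvd_iff (f := 1)).1 h.dvd
    simp at h1
  · rw [x_dvd_iff, MulMemClass.coe_mul, map_mul, mul_eq_zero] at h
    rwa [x_dvd_iff, x_dvd_iff]

/-- The first coefficients of the restriction to the line `x = 0`. -/
def jet (n : ℕ) : ConvergentSeries →ₗ[ℂ] (Fin n → ℂ) :=
  LinearMap.pi fun i => (PowerSeries.coeff (i : ℕ)).comp
    (restrict.toLinearMap.comp ConvergentSeries.val.toLinearMap)

theorem jet_apply (n : ℕ) (f : ConvergentSeries) (i : Fin n) :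
    jet n f i = PowerSeries.coeff (i : ℕ) (restrict f) := rfl

theorem jet_surjective (n : ℕ) : Function.Surjective (jet n) := by
  intro v
  refine ⟨∑ i : Fin n, v i • y ^ (i : ℕ), funext fun j => ?_⟩
  have h : ∀ i : Fin n, jet n (y ^ (i : ℕ)) j = if j = i then 1 else 0 := fun i => by
    rw [jet_apply, SubmonoidClass.coe_pow, map_pow, coe_y, restrict_X_one, PowerSeries.coeff_X_pow]
    simp [Fin.ext_iff]
  simp only [map_sum, map_smul, Finset.sum_apply, Pi.smul_apply, h]
  simp

/-- The ideal (x, h) is the kernel of the surjective map `jet n`: if f restricts to yⁿ b on x = 0,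
then f - c⁻¹ b h vanishes there and is divisible by x. -/
theorem colength_x {h : ConvergentSeries} {c : ℂ} {n : ℕ} (hc : c ≠ 0)
    (hh : restrict h = PowerSeries.C c * PowerSeries.X ^ n) : colength x h = n := by
  have hker : (Ideal.span {x, h}).restrictScalars ℂ = LinearMap.ker (jet n) := by
    ext f
    rw [Submodule.restrictScalars_mem, Ideal.mem_span_pair, LinearMap.mem_ker]
    constructor
    · rintro ⟨a, b, rfl⟩
      funext i
      rw [jet_apply]
      simp only [AddMemClass.coe_add, MulMemClass.coe_mul, map_add, map_mul, coe_x,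
        restrict_X_zero, hh, mul_zero, zero_add]
      rw [← mul_assoc, PowerSeries.coeff_mul_X_pow', if_neg (by simp), Pi.zero_apply]
    · intro hf
      have hd : PowerSeries.X ^ n ∣ restrict f := by
        rw [PowerSeries.X_pow_dvd_iff]
        exact fun m hm => congrFun hf ⟨m, hm⟩
      let b : ConvergentSeries := ⟨_, f.2.shift (Finsupp.single 1 n)⟩
      have hb : restrict f = PowerSeries.X ^ n * restrict b := by
        obtain ⟨k, hk⟩ := hd
        rw [hk]
        congr 1
        ext m
        have h1 : PowerSeries.coeff m (restrict b) =
            PowerSeries.coeff (m + n) (restrict f) := by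
          rw [coeff_restrict, coeff_restrict, Finsupp.single_add]
          rfl
        rw [h1, hk, mul_comm, PowerSeries.coeff_mul_X_pow]
      have hx : x ∣ f - c⁻¹ • (b * h) := by
        rw [x_dvd_iff]
        simp only [AddSubgroupClass.coe_sub, SetLike.val_smul, MulMemClass.coe_mul, map_sub,
          map_smul, map_mul, hh, hb]
        rw [PowerSeries.smul_eq_C_mul]
        have hcc : PowerSeries.C c⁻¹ * PowerSeries.C c = 1 := by
          rw [← map_mul, inv_mul_cancel₀ hc, map_one]
        linear_combination (-(restrict b * PowerSeries.X ^ n)) * hcc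
      obtain ⟨a, ha⟩ := hx
      refine ⟨a, c⁻¹ • b, ?_⟩
      rw [smul_mul_assoc]
      linear_combination -ha
  have e : (ConvergentSeries ⧸ Ideal.span {x, h}) ≃ₗ[ℂ] (Fin n → ℂ) :=
    (Submodule.Quotient.restrictScalarsEquiv ℂ (Ideal.span {x, h})).symm.trans
      ((Submodule.quotEquivOfEq _ _ hker).trans
        ((jet n).quotKerEquivOfSurjective (jet_surjective n)))
  rw [colength, e.length_eq, Module.length_eq_finrank]
  simp

end ConvergentSeries

/-! ### The Milnor number -/

theorem germ_add (p q : MvPolynomial (Fin 2) ℂ) : germ (p + q) = germ p + germ q :=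
  Subtype.ext (MvPolynomial.coe_add p q)

theorem germ_mul (p q : MvPolynomial (Fin 2) ℂ) : germ (p * q) = germ p * germ q :=
  Subtype.ext (MvPolynomial.coe_mul p q)

/-- The passage from polynomials to germs, as a ring homomorphism. -/
def germHom : MvPolynomial (Fin 2) ℂ →+* ConvergentSeries where
  toFun := germ
  map_one' := Subtype.ext MvPolynomial.coe_one
  map_mul' := germ_mul
  map_zero' := Subtype.ext MvPolynomial.coe_zero
  map_add' := germ_add

theorem germHom_X_zero : germHom (X 0) = ConvergentSeries.x := rfl

/-- The restriction of a polynomial germ to the line `x = 0`. -/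
def restrictGerm : MvPolynomial (Fin 2) ℂ →+* PowerSeries ℂ :=
  (restrict.toRingHom.comp ConvergentSeries.val.toRingHom).comp germHom

theorem restrictGerm_apply (p : MvPolynomial (Fin 2) ℂ) :
    restrictGerm p = restrict (germHom p) := rfl

theorem restrictGerm_X_zero : restrictGerm (X 0) = 0 := by
  rw [restrictGerm_apply, germHom_X_zero, ConvergentSeries.coe_x, restrict_X_zero]

theorem restrictGerm_X_one : restrictGerm (X 1) = PowerSeries.X := by
  rw [restrictGerm_apply, ← restrict_X_one, ← ConvergentSeries.coe_y]
  rfl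

-- The second conclusion is the regularity that additivity of `colength` requires.
open ConvergentSeries in
theorem colength_x_germHom {p : MvPolynomial (Fin 2) ℂ} {c : ℂ} {n : ℕ} (hc : c ≠ 0)
    (h : restrictGerm p = PowerSeries.C c * PowerSeries.X ^ n) :
    colength x (germHom p) = n ∧ ∀ a, x ∣ germHom p * a → x ∣ a := by
  refine ⟨colength_x hc h, fun a ha => (prime_x.dvd_or_dvd ha).resolve_left fun h0 => ?_⟩
  rw [x_dvd_iff, ← restrictGerm_apply, h, mul_eq_zero] at h0
  rcases h0 with h0 | h0
  · exact hc (by simpa using h0)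
  · exact pow_ne_zero _ PowerSeries.X_ne_zero h0

open ConvergentSeries in
theorem milnorNumber_omegaLocal : milnorNumber omegaLocal = 57 := by
  set g := germHom conicGerm with hg
  set c := germHom sexticGerm with hc
  set p := germHom (omegaLocal 0) with hp
  set q := germHom (sexticGerm * (X 0 - 2 * X 1) - X 0 * conicGerm ^ 3) with hq
  have rg : restrictGerm conicGerm = PowerSeries.C (-1) * PowerSeries.X ^ 2 := by
    simp [conicGerm, restrictGerm_X_zero, restrictGerm_X_one]
  have rc : restrictGerm sexticGerm = PowerSeries.C (-1) * PowerSeries.X ^ 6 := by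
    simp [sexticGerm, rg, restrictGerm_X_zero, restrictGerm_X_one]
    ring
  have rp : restrictGerm (omegaLocal 0) = PowerSeries.C (-2) * PowerSeries.X ^ 8 := by
    simp [omegaLocal, rc, restrictGerm_X_zero, restrictGerm_X_one, map_ofNat]
    ring
  have rq : restrictGerm (sexticGerm * (X 0 - 2 * X 1) - X 0 * conicGerm ^ 3) =
      PowerSeries.C 2 * PowerSeries.X ^ 7 := by
    simp [rc, restrictGerm_X_zero, restrictGerm_X_one, map_ofNat]
    ring
  obtain ⟨lg, dg⟩ := colength_x_germHom (by norm_num) rg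
  obtain ⟨lc, dc⟩ := colength_x_germHom (by norm_num) rc
  obtain ⟨lp, dp⟩ := colength_x_germHom (by norm_num) rp
  obtain ⟨lq, dq⟩ := colength_x_germHom (by norm_num) rq
  rw [← hg] at lg dg
  rw [← hc] at lc dc
  rw [← hp] at lp dp
  rw [← hq] at lq dq
  have hx0 := prime_x.ne_zero
  have hg0 : g ≠ 0 := fun h => by
    have := rg
    rw [restrictGerm_apply, ← hg, h] at this
    simp at this
  have hcg : c = x ^ 6 + (g ^ 2 - x ^ 3 * (2 * x + germHom (X 1))) * g := by
    rw [hc, hg, ← germHom_X_zero, sexticGerm]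
    simp only [map_add, map_sub, map_mul, map_pow, map_ofNat]
    ring
  -- Regularity of the pair (x, g) is turned around, so that factors g can be split off as well.
  have gx : ∀ a, g ∣ x * a → g ∣ a := by
    rintro a ⟨b, hb⟩
    obtain ⟨d, rfl⟩ := dg b ⟨a, hb.symm⟩
    exact ⟨d, mul_left_cancel₀ hx0 (by linear_combination hb)⟩
  have gx6 : ∀ a, g ∣ c * a → g ∣ a := fun a ha => by
    have h6 : g ∣ x * (x * (x * (x * (x * (x * a))))) := by
      convert ha.sub (dvd_mul_right g ((g ^ 2 - x ^ 3 * (2 * x + germHom (X 1))) * a)) using 1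
      rw [hcg]
      ring
    exact gx _ (gx _ (gx _ (gx _ (gx _ (gx _ h6)))))
  -- Euclid's algorithm, read upwards: c ≡ x⁶ mod g gives 6 · 2 = 12; q ≡ -x g³ mod c gives 6 + 3 ·
  -- 12 = 42; p ≡ -x c mod q gives 7 + 42 = 49; the second coefficient is x q, which gives 8 + 49 =
  -- 57.
  have h1 : colength g c = 12 := by
    rw [colength_comm, colength_eq_of_neg_eq_add_mul (f' := -x ^ 6)
      (-(g ^ 2 - x ^ 3 * (2 * x + germHom (X 1)))) (by rw [hcg]; ring)]
    rw [colength_eq_of_neg_eq_add_mul (f' := x ^ 6) 0 (by ring), colength_pow hx0 dg, lg]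
    norm_num
  have h2 : colength (g ^ 3) c = 36 := by
    rw [colength_pow hg0 gx6, h1]
    norm_num
  have h3 : colength c q = 42 := by
    have h : x * g ^ 3 = -q + (x - 2 * germHom (X 1)) * c := by
      rw [hq, hg, hc, ← germHom_X_zero]
      simp only [map_sub, map_mul, map_pow, map_ofNat]
      ring
    have h' : -(x * g ^ 3) = q + (-(x - 2 * germHom (X 1))) * c := by
      linear_combination -h
    rw [colength_comm, colength_eq_of_neg_eq_add_mul _ h', colength_mul hx0 dc, h2, lc]
    norm_num
  have h4 : colength q p = 49 := by
    have h : -(x * c) = p + germHom (X 1) * q := by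
      rw [hp, hq, hc, ← germHom_X_zero]
      simp only [omegaLocal, Matrix.cons_val, map_add, map_sub, map_mul, map_pow, map_ofNat]
      ring
    rw [colength_comm, colength_eq_of_neg_eq_add_mul _ h, colength_mul hx0 dq, h3, lq]
    norm_num
  have h5 : colength (germ (omegaLocal 0)) (germ (omegaLocal 1)) = 57 := by
    have h : germ (omegaLocal 1) = x * q := by
      rw [hq, ← germHom_X_zero, ← map_mul]
      rfl
    rw [colength_comm, h]
    change colength (x * q) p = 57
    rw [colength_mul hx0 dp, h4, lp]
    norm_num
  rw [colength, Module.length_eq_rank] at h5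
  rw [milnorNumber, Module.finrank]
  have := congrArg ENat.toNat h5
  simpa using this

end PlaneFoliation

end

/-! ### Four blow-ups ending at a saddle-node tangent to the exceptional divisor. -/

noncomputable section

namespace PlaneFoliation

open MvPolynomial

/-! ### Reduction of the singular point -/

theorem charpoly_linearPart (ω : Form 2) :
    (linearPart ω).charpoly = Polynomial.X ^ 2 -
      Polynomial.C (eval 0 (pderiv 0 (ω 1)) - eval 0 (pderiv 1 (ω 0))) * Polynomial.X +
      Polynomial.C (eval 0 (pderiv 1 (ω 1)) * eval 0 (pderiv 0 (ω 0)) -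
        eval 0 (pderiv 0 (ω 1)) * eval 0 (pderiv 1 (ω 0))) := by
  rw [Matrix.charpoly_fin_two, Matrix.trace_fin_two, Matrix.det_fin_two]
  simp only [linearPart, Matrix.of_apply, Matrix.cons_val, map_neg, map_sub, map_add, map_mul]
  ring

/-- If the linear part has the double eigenvalue `a`, then the singular point is not reduced. -/
theorem not_isReduced_of_charpoly {ω : Form 2} {a : ℂ}
    (h : (linearPart ω).charpoly = (Polynomial.X - Polynomial.C a) ^ 2) : ¬ IsReduced ω := by
  have key : ∀ b : ℂ, (linearPart ω).charpoly.eval b = 0 → b = a := fun b hb => by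
    rw [h] at hb
    simpa [sub_eq_zero] using hb
  rintro (⟨-, b, hb, hc⟩ | ⟨-, b, c, hb, hc, hq, hch⟩)
  · have h0 := key 0 (by rw [hc]; simp)
    have h1 := key b (by rw [hc]; simp)
    exact hb (h1.trans h0.symm)
  · have h0 := key b (by rw [hch]; simp)
    have h1 := key c (by rw [hch]; simp)
    refine hq 1 one_pos ?_
    rw [h0, h1]
    simp [← h1, hc]

theorem not_X_dvd_of_eval_ne_zero {f : MvPolynomial (Fin 2) ℂ} {i : Fin 2} (v : Fin 2 → ℂ)
    (hv : v i = 0) (h : eval v f ≠ 0) : ¬ X i ∣ f := by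
  rintro ⟨k, rfl⟩
  simp [hv] at h

/-- Non-units have order at least 1, so a product of two of them has order at least 2. -/
theorem irreducible_of_order_eq_one {f : MvPowerSeries (Fin 2) ℂ} (hf : f.order = 1) :
    Irreducible f := by
  have hu : ∀ g : MvPowerSeries (Fin 2) ℂ, ¬ IsUnit g → 1 ≤ g.order := fun g hg => by
    rw [MvPowerSeries.one_le_order_iff_constCoeff_eq_zero]
    by_contra h
    exact hg (MvPowerSeries.isUnit_iff_constantCoeff.2 (isUnit_iff_ne_zero.2 h))
  refine ⟨fun h => ?_, fun a b hab => ?_⟩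
  · have h1 := (MvPowerSeries.one_le_order_iff_constCoeff_eq_zero).1 hf.ge
    have h2 := MvPowerSeries.isUnit_iff_constantCoeff.1 h
    rw [h1] at h2
    exact not_isUnit_zero h2
  · by_contra! h
    have h1 := add_le_add (hu a h.1) (hu b h.2)
    have h2 := h1.trans MvPowerSeries.le_order_mul
    rw [← hab, hf] at h2
    exact absurd h2 (by decide)

theorem order_X (i : Fin 2) : (MvPowerSeries.X i : MvPowerSeries (Fin 2) ℂ).order = 1 := by
  rw [MvPowerSeries.X, MvPowerSeries.order_monomial_of_ne_zero one_ne_zero]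
  simp

theorem isFormalSeparatrix_X_one {ω : Form 2} (h : X 1 ∣ ω 0) :
    IsFormalSeparatrix ω (MvPowerSeries.X 1) := by
  refine ⟨irreducible_of_order_eq_one (order_X 1), ?_⟩
  rw [MvPowerSeries.pderiv_X_self, MvPowerSeries.pderiv_X_of_ne (by decide), mul_one, mul_zero,
    sub_zero, ← MvPolynomial.coe_X]
  obtain ⟨k, hk⟩ := h
  exact ⟨k, by rw [hk]; push_cast; rfl⟩

/-- The form after one blow-up of `omegaLocal`, in the chart `(uv, v)`. -/
def blowUp₁ : Form 2 :=
  let g : MvPolynomial (Fin 2) ℂ := X 0 - X 1 + X 0 * X 1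
  let c := g ^ 3 - X 0 ^ 3 * X 1 ^ 2 * (2 * X 0 + 1) * g + X 0 ^ 6 * X 1 ^ 3
  ![X 1 * (c * (2 * X 1 - X 0 - X 0 * X 1) + X 0 * X 1 * g ^ 3), -(X 0 ^ 2 * c)]

/-- The form after two blow-ups, in the chart `(u, u (v + 1))`. -/
def blowUp₂ : Form 2 :=
  let g : MvPolynomial (Fin 2) ℂ := X 0 + X 0 * X 1 - X 1
  let c := g ^ 3 - X 0 ^ 3 * (X 1 + 1) ^ 2 * (2 * X 0 + 1) * g + X 0 ^ 6 * (X 1 + 1) ^ 3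
  ![(X 1 + 1) * (c * (2 * X 1 - X 0 * (X 1 + 1)) + X 0 * (X 1 + 1) * g ^ 3), -(X 0 * c)]

/-- The form after three blow-ups, in the chart `(u, uv)`. -/
def blowUp₃ : Form 2 :=
  let m : MvPolynomial (Fin 2) ℂ := 1 + X 0 * X 1
  let g := m - X 1
  let c := g ^ 3 - X 0 * m ^ 2 * (2 * X 0 + 1) * g + X 0 ^ 3 * m ^ 3
  ![m * (c * (2 * X 1 - m) + m * g ^ 3) - X 1 * c, -(X 0 * c)]

/-- The form after four blow-ups, in the chart `(uv, v)`. -/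
def blowUp₄ : Form 2 :=
  let m : MvPolynomial (Fin 2) ℂ := 1 + X 0 * X 1 ^ 2
  let g := m - X 1
  let e := X 0 * (X 0 ^ 2 * X 1 ^ 2 * m ^ 3 - m ^ 2 * (2 * X 0 * X 1 + 1) * g)
  let r := g ^ 3 * (2 * m - 1) + e * (2 * X 1 * m - m ^ 2 - X 1)
  ![X 1 * r, X 0 * (r - (g ^ 3 + X 1 * e))]

/-- The exponents 4, 5, 4, 1 divided out in the four blow-ups are the multiplicities of the points
blown up. -/
theorem isStrictTransform_blowUp₁ :
    IsStrictTransform ![X 0 * X 1, X 1] 1 omegaLocal blowUp₁ := by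
  refine ⟨4, funext fun i => ?_, fun h => ?_⟩
  · fin_cases i <;>
      simp [pullback, omegaLocal, sexticGerm, conicGerm, blowUp₁, pderiv_X, map_ofNat] <;> ring
  · refine not_X_dvd_of_eval_ne_zero ![1, 0] (by simp) ?_ (h 1)
    simp [blowUp₁]

theorem isStrictTransform_blowUp₂ :
    IsStrictTransform ![X 0, X 0 * (X 1 + C 1)] 0 blowUp₁ blowUp₂ := by
  refine ⟨5, funext fun i => ?_, fun h => ?_⟩
  · fin_cases i <;> simp [pullback, blowUp₁, blowUp₂, pderiv_X, map_ofNat] <;> ring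
  · refine not_X_dvd_of_eval_ne_zero ![0, 1] (by simp) ?_ (h 0)
    simp [blowUp₂]

theorem isStrictTransform_blowUp₃ :
    IsStrictTransform ![X 0, X 0 * (X 1 + C 0)] 0 blowUp₂ blowUp₃ := by
  refine ⟨4, funext fun i => ?_, fun h => ?_⟩
  · fin_cases i <;> simp [pullback, blowUp₂, blowUp₃, pderiv_X, map_ofNat] <;> ring
  · refine not_X_dvd_of_eval_ne_zero ![0, 2] (by simp) ?_ (h 0)
    simp [blowUp₃]
    norm_num

theorem isStrictTransform_blowUp₄ :
    IsStrictTransform ![X 0 * X 1, X 1] 1 blowUp₃ blowUp₄ := by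
  refine ⟨1, funext fun i => ?_, fun h => ?_⟩
  · fin_cases i <;> simp [pullback, blowUp₃, blowUp₄, pderiv_X, map_ofNat] <;> ring
  · refine not_X_dvd_of_eval_ne_zero ![1, 0] (by simp) ?_ (h 1)
    simp [blowUp₄, map_ofNat]
    norm_num

theorem isSingular_iff {ω : Form 2} : IsSingular ω ↔ eval 0 (ω 0) = 0 ∧ eval 0 (ω 1) = 0 :=
  Fin.forall_fin_two

theorem not_isReduced_omegaLocal : ¬ IsReduced omegaLocal := by
  refine not_isReduced_of_charpoly (a := 0) ?_
  rw [charpoly_linearPart]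
  simp [omegaLocal, sexticGerm, conicGerm, pderiv_X]

theorem not_isReduced_blowUp₁ : ¬ IsReduced blowUp₁ := by
  refine not_isReduced_of_charpoly (a := 0) ?_
  rw [charpoly_linearPart]
  simp [blowUp₁, pderiv_X]

theorem not_isReduced_blowUp₂ : ¬ IsReduced blowUp₂ := by
  refine not_isReduced_of_charpoly (a := 0) ?_
  rw [charpoly_linearPart]
  simp [blowUp₂, pderiv_X]

/-- The linear part is a Jordan block with eigenvalue -1. Its eigendirection X 0 = 0 is the origin
of the next chart, where the saddle-node appears. -/
theorem not_isReduced_blowUp₃ : ¬ IsReduced blowUp₃ := by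
  refine not_isReduced_of_charpoly (a := -1) ?_
  rw [charpoly_linearPart]
  simp [blowUp₃, pderiv_X, map_ofNat]
  ring

theorem isSaddleNode_blowUp₄ : IsSaddleNode blowUp₄ := by
  refine ⟨isSingular_iff.2 (by simp [blowUp₄]), -1, by norm_num, ?_⟩
  rw [charpoly_linearPart]
  simp [blowUp₄, pderiv_X, map_ofNat]
  ring

/-- The linear part kills exactly the direction of the axis X 1 = 0, which is the exceptional curve
of the last blow-up. -/
theorem isWeakSeparatrix_blowUp₄ : IsWeakSeparatrix blowUp₄ (MvPowerSeries.X 1) := by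
  refine ⟨isFormalSeparatrix_X_one (Dvd.intro _ rfl), order_X 1, fun w hw => ?_⟩
  have h := congrFun hw 1
  simp [linearPart, Matrix.mulVec, dotProduct, blowUp₄, pderiv_X, map_ofNat] at h
  norm_num at h
  simp [MvPowerSeries.coeff_X, h, Finsupp.single_left_inj]

theorem inReduction_blowUp₄ : InReduction omegaLocal ⟨blowUp₄, {1, 0}⟩ := by
  have h1 : InReduction omegaLocal ⟨blowUp₁, {1}⟩ :=
    .step .base (isSingular_iff.2 (by simp [omegaLocal])) not_isReduced_omegaLocal
      (.inr ⟨isStrictTransform_blowUp₁, by ext; simp⟩)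
  have h2 : InReduction omegaLocal ⟨blowUp₂, {0}⟩ :=
    .step h1 (isSingular_iff.2 (by simp [blowUp₁])) not_isReduced_blowUp₁
      -- The value 1 is the tangent direction of the transformed conic; it is not that of the first
      -- exceptional curve, which therefore leaves the divisor.
      (.inl ⟨1, isStrictTransform_blowUp₂, by ext; simp⟩)
  have h3 : InReduction omegaLocal ⟨blowUp₃, {0}⟩ :=
    .step h2 (isSingular_iff.2 (by simp [blowUp₂])) not_isReduced_blowUp₂
      (.inl ⟨0, isStrictTransform_blowUp₃, by ext; simp⟩)
  exact .step h3 (isSingular_iff.2 (by simp [blowUp₃])) not_isReduced_blowUp₃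
    (.inr ⟨isStrictTransform_blowUp₄, by ext; simp⟩)

theorem not_isSecondType_omegaTilde : ¬ IsSecondType omegaTilde := by
  intro h
  have h1 := h 2 ![0, 0, 1] (by simp) ((eval_omegaTilde_eq_zero_iff _).2 (by simp))
  rw [localForm_omegaTilde] at h1
  exact h1 _ inReduction_blowUp₄ isSaddleNode_blowUp₄ 1 (by simp) isWeakSeparatrix_blowUp₄

end PlaneFoliation

end

/-! ### One-variable convergence and the implicit function theorem by majorants. -/

noncomputable section

namespace PlaneFoliation

/-! ### Convergent power series in one variable -/

/-- A formal power series in one variable is convergent if it has a positive radius of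
convergence. -/
def IsConvergentOne (a : PowerSeries ℂ) : Prop :=
  ∃ r : ℝ, 0 < r ∧ Summable fun n => ‖PowerSeries.coeff n a‖ * r ^ n

/-- The power series in two variables that depends only on the variable `X i`. -/
def embed (i : Fin 2) : PowerSeries ℂ →ₐ[ℂ] MvPowerSeries (Fin 2) ℂ :=
  PowerSeries.substAlgHom (PowerSeries.HasSubst.X i)

theorem coeff_embed (i : Fin 2) (a : PowerSeries ℂ) (n : Fin 2 →₀ ℕ) :
    MvPowerSeries.coeff n (embed i a) =
      if n = Finsupp.single i (n i) then PowerSeries.coeff (n i) a else 0 := by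
  rw [embed, PowerSeries.coe_substAlgHom, PowerSeries.coeff_subst_single]

theorem embed_X (i : Fin 2) : embed i PowerSeries.X = MvPowerSeries.X i :=
  PowerSeries.substAlgHom_X _

theorem constantCoeff_embed (i : Fin 2) (a : PowerSeries ℂ) :
    MvPowerSeries.constantCoeff (embed i a) = PowerSeries.constantCoeff a := by
  rw [← MvPowerSeries.coeff_zero_eq_constantCoeff_apply, coeff_embed]
  simp

theorem pderiv_embed_self (i : Fin 2) (a : PowerSeries ℂ) :
    MvPowerSeries.pderiv ℂ i (embed i a) = embed i (PowerSeries.derivative ℂ a) := by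
  ext n
  rw [MvPowerSeries.coeff_pderiv, coeff_embed, coeff_embed, PowerSeries.coeff_derivative]
  have h : n + Finsupp.single i 1 = Finsupp.single i (n i + 1) ↔ n = Finsupp.single i (n i) := by
    rw [Finsupp.single_add, add_left_inj]
  simp only [Finsupp.add_apply, Finsupp.single_eq_same, h]
  split_ifs <;> simp

theorem pderiv_embed_of_ne {i j : Fin 2} (hij : i ≠ j) (a : PowerSeries ℂ) :
    MvPowerSeries.pderiv ℂ i (embed j a) = 0 := by
  ext n
  rw [MvPowerSeries.coeff_pderiv, coeff_embed, if_neg, zero_mul, map_zero]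
  intro h
  have := DFunLike.congr_fun h i
  simp [hij] at this

theorem isConvergent_embed_iff (i : Fin 2) (a : PowerSeries ℂ) :
    IsConvergent (embed i a) ↔ IsConvergentOne a := by
  refine exists_congr fun r => and_congr_right fun _ => ?_
  rw [← (Finsupp.single_injective i).summable_iff]
  · refine summable_congr fun n => ?_
    simp [coeff_embed]
  · intro n hn
    rw [coeff_embed, if_neg fun h => hn ⟨_, h.symm⟩]
    simp

theorem IsConvergentOne.mul {a b : PowerSeries ℂ} (ha : IsConvergentOne a)
    (hb : IsConvergentOne b) : IsConvergentOne (a * b) := by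
  rw [← isConvergent_embed_iff 0, map_mul]
  exact ((isConvergent_embed_iff 0 a).2 ha).mul ((isConvergent_embed_iff 0 b).2 hb)

theorem IsConvergentOne.add {a b : PowerSeries ℂ} (ha : IsConvergentOne a)
    (hb : IsConvergentOne b) : IsConvergentOne (a + b) := by
  rw [← isConvergent_embed_iff 0, map_add]
  exact ((isConvergent_embed_iff 0 a).2 ha).add ((isConvergent_embed_iff 0 b).2 hb)

theorem isConvergentOne_coe (p : Polynomial ℂ) : IsConvergentOne (p : PowerSeries ℂ) := by
  refine ⟨1, one_pos, summable_of_ne_finset_zero (s := p.support) fun n hn => ?_⟩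
  rw [Polynomial.coeff_coe, Polynomial.notMem_support_iff.mp hn]
  simp

theorem IsConvergentOne.of_X_mul {a : PowerSeries ℂ} (h : IsConvergentOne (PowerSeries.X * a)) :
    IsConvergentOne a := by
  obtain ⟨r, hr, h⟩ := h
  refine ⟨r, hr, (((summable_nat_add_iff 1).2 h).mul_right r⁻¹).congr fun n => ?_⟩
  rw [PowerSeries.coeff_succ_X_mul, pow_succ]
  field_simp

theorem IsConvergentOne.of_X_pow_mul {a : PowerSeries ℂ} {n : ℕ}
    (h : IsConvergentOne (PowerSeries.X ^ n * a)) : IsConvergentOne a := by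
  induction n with
  | zero => simpa using h
  | succ n ih =>
    rw [pow_succ', mul_assoc] at h
    exact ih h.of_X_mul

/-! ### The implicit function theorem for convergent power series -/

/-- The weighted sum of the absolute values of the first `N` coefficients. -/
def partialNorm (ρ : ℝ) (N : ℕ) (a : PowerSeries ℂ) : ℝ :=
  ∑ n ∈ Finset.range N, ‖PowerSeries.coeff n a‖ * ρ ^ n

section partialNorm

variable {ρ : ℝ}

theorem partialNorm_nonneg (hρ : 0 ≤ ρ) (N : ℕ) (a : PowerSeries ℂ) : 0 ≤ partialNorm ρ N a :=
  Finset.sum_nonneg fun _ _ => by positivity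

theorem partialNorm_mul_le (hρ : 0 ≤ ρ) (N : ℕ) (a b : PowerSeries ℂ) :
    partialNorm ρ N (a * b) ≤ partialNorm ρ N a * partialNorm ρ N b := by
  let F : ℕ × ℕ → ℝ := fun p =>
    (‖PowerSeries.coeff p.1 a‖ * ρ ^ p.1) * (‖PowerSeries.coeff p.2 b‖ * ρ ^ p.2)
  have h1 : partialNorm ρ N (a * b) ≤
      ∑ n ∈ Finset.range N, ∑ p ∈ Finset.HasAntidiagonal.antidiagonal n, F p := by
    refine Finset.sum_le_sum fun n _ => ?_
    rw [PowerSeries.coeff_mul]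
    refine (mul_le_mul_of_nonneg_right (norm_sum_le _ _) (pow_nonneg hρ _)).trans ?_
    rw [Finset.sum_mul]
    refine Finset.sum_le_sum fun p hp => ?_
    rw [← Finset.HasAntidiagonal.mem_antidiagonal.1 hp, norm_mul, pow_add]
    exact le_of_eq (by simp only [F]; ring)
  refine h1.trans ?_
  rw [partialNorm, partialNorm, Finset.sum_mul_sum, ← Finset.sum_product', ← Finset.sum_biUnion]
  · refine Finset.sum_le_sum_of_subset_of_nonneg (fun p hp => ?_) fun p _ _ => ?_
    · simp only [Finset.mem_biUnion, Finset.mem_range, Finset.HasAntidiagonal.mem_antidiagonal] at hp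
      simp only [Finset.mem_product, Finset.mem_range]
      omega
    · simp only [F]
      positivity
  · intro m _ n _ hmn
    rw [Function.onFun, Finset.disjoint_left]
    intro p hp hp'
    rw [Finset.HasAntidiagonal.mem_antidiagonal] at hp hp'
    omega

theorem partialNorm_one_le (N : ℕ) : partialNorm ρ N 1 ≤ 1 := by
  rcases N with _ | N
  · simp [partialNorm]
  · rw [partialNorm, Finset.sum_range_succ']
    simp [PowerSeries.coeff_one]

theorem partialNorm_X_mul (N : ℕ) (a : PowerSeries ℂ) :
    partialNorm ρ (N + 1) (PowerSeries.X * a) = ρ * partialNorm ρ N a := by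
  rw [partialNorm, Finset.sum_range_succ', partialNorm, Finset.mul_sum]
  simp only [PowerSeries.coeff_succ_X_mul, PowerSeries.coeff_zero_X_mul, norm_zero, zero_mul,
    add_zero]
  exact Finset.sum_congr rfl fun n _ => by ring

theorem partialNorm_mono (hρ : 0 ≤ ρ) {M N : ℕ} (h : M ≤ N) (a : PowerSeries ℂ) :
    partialNorm ρ M a ≤ partialNorm ρ N a :=
  Finset.sum_le_sum_of_subset_of_nonneg (Finset.range_subset_range.2 h) fun _ _ _ => by positivity

theorem partialNorm_X_pow_mul_le (hρ : 0 ≤ ρ) (k N : ℕ) (a : PowerSeries ℂ) :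
    partialNorm ρ N (PowerSeries.X ^ k * a) ≤ ρ ^ k * partialNorm ρ N a := by
  induction k with
  | zero => simp
  | succ k ih =>
    rcases N with _ | N
    · simp [partialNorm]
    · rw [pow_succ', mul_assoc, partialNorm_X_mul, pow_succ', mul_assoc]
      exact mul_le_mul_of_nonneg_left ((partialNorm_mono hρ (Nat.le_succ N) _).trans ih) hρ

theorem partialNorm_pow_le (hρ : 0 ≤ ρ) (N k : ℕ) (a : PowerSeries ℂ) :
    partialNorm ρ N (a ^ k) ≤ partialNorm ρ N a ^ k := by
  induction k with
  | zero => simpa using partialNorm_one_le N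
  | succ k ih =>
    rw [pow_succ, pow_succ]
    exact (partialNorm_mul_le hρ N _ _).trans
      (mul_le_mul_of_nonneg_right ih (partialNorm_nonneg hρ N a))

/-- The part of degree at least two of an implicit equation only involves the earlier
coefficients. -/
theorem partialNorm_X_pow_mul_pow_le (hρ : 0 ≤ ρ) (N : ℕ) (a : PowerSeries ℂ) (m i : ℕ) :
    partialNorm ρ (N + 1) (PowerSeries.X ^ (m + 1) * a ^ i) ≤
      ρ ^ (m + 1) * partialNorm ρ N a ^ i := by
  rw [pow_succ', mul_assoc, partialNorm_X_mul, pow_succ', mul_assoc]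
  refine mul_le_mul_of_nonneg_left ((partialNorm_X_pow_mul_le hρ _ _ _).trans ?_) hρ
  exact mul_le_mul_of_nonneg_left (partialNorm_pow_le hρ N i a) (pow_nonneg hρ _)

end partialNorm

theorem isConvergentOne_of_partialNorm_le {a : PowerSeries ℂ} {ρ K : ℝ} (hρ : 0 < ρ)
    (h : ∀ N, partialNorm ρ N a ≤ K) : IsConvergentOne a :=
  ⟨ρ, hρ, summable_of_sum_range_le (fun _ => by positivity) h⟩

theorem hasSubst_pair {b c : PowerSeries ℂ} (hb : PowerSeries.constantCoeff b = 0)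
    (hc : PowerSeries.constantCoeff c = 0) :
    MvPowerSeries.HasSubst (![b, c] : Fin 2 → PowerSeries ℂ) := by
  refine MvPowerSeries.hasSubst_of_constantCoeff_zero fun i => ?_
  fin_cases i
  exacts [hb, hc]

/-- Solving the equation `F(t a(t), t) = 0` for a coefficient of `a`; finitely many terms of `F`
suffice for any given number of coefficients. -/
theorem coeff_mul_coeff_eq {F : MvPowerSeries (Fin 2) ℂ} {a : PowerSeries ℂ}
    (hF : F.subst ![PowerSeries.X * a, PowerSeries.X] = 0) (N : ℕ) :
    ∃ S : Finset (Fin 2 →₀ ℕ), Finsupp.single 0 1 ∉ S ∧ ∀ n < N,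
      MvPowerSeries.coeff (Finsupp.single 0 1) F * PowerSeries.coeff n a =
        -∑ d ∈ S, MvPowerSeries.coeff d F *
          PowerSeries.coeff (n + 1) (PowerSeries.X ^ (d 0 + d 1) * a ^ d 0) := by
  have hs := hasSubst_pair (b := PowerSeries.X * a) (c := PowerSeries.X) (by simp) (by simp)
  have hprod : ∀ d : Fin 2 →₀ ℕ, (d.prod fun s e =>
      (![PowerSeries.X * a, PowerSeries.X] : Fin 2 → PowerSeries ℂ) s ^ e) =
        PowerSeries.X ^ (d 0 + d 1) * a ^ d 0 := fun d => by
    rw [Finsupp.prod_fintype _ _ (by simp), Fin.prod_univ_two]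
    simp only [Matrix.cons_val]
    ring
  let f : ℕ → (Fin 2 →₀ ℕ) → ℂ := fun n d => MvPowerSeries.coeff d F *
    PowerSeries.coeff (n + 1) (PowerSeries.X ^ (d 0 + d 1) * a ^ d 0)
  have hfin : ∀ n, (Function.support (f n)).Finite := fun n => by
    have := MvPowerSeries.coeff_subst_finite hs F (Finsupp.single () (n + 1))
    simp only [hprod] at this
    exact this
  have hsum : ∀ n, ∑ᶠ d, f n d = 0 := fun n => by
    have h := MvPowerSeries.coeff_subst hs F (Finsupp.single () (n + 1))
    simp only [hprod, hF, map_zero] at h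
    exact h.symm
  -- `T` collects the indices that matter for n < N. The index (1, 0), whose term is the n-th
  -- coefficient of a, is moved to the other side.
  let T := (Finset.range N).biUnion fun n => (hfin n).toFinset
  refine ⟨(insert (Finsupp.single 0 1) T).erase (Finsupp.single 0 1),
    Finset.notMem_erase _ _, fun n hn => ?_⟩
  have h1 : f n (Finsupp.single 0 1) =
      MvPowerSeries.coeff (Finsupp.single 0 1) F * PowerSeries.coeff n a := by
    simp [f, PowerSeries.coeff_succ_X_mul]
  rw [eq_neg_iff_add_eq_zero, ← h1]
  change f n _ + ∑ d ∈ _, f n d = 0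
  rw [Finset.add_sum_erase _ _ (Finset.mem_insert_self _ _),
    ← finsum_eq_sum_of_support_subset _ fun d hd => ?_, hsum]
  refine Finset.mem_coe.2 (Finset.mem_insert_of_mem (Finset.mem_biUnion.2 ?_))
  exact ⟨n, Finset.mem_range.2 hn, (hfin n).mem_toFinset.2 hd⟩

/-- A formal solution of a convergent equation that satisfies the condition of the implicit
function theorem converges. -/
theorem isConvergentOne_of_subst_eq_zero {F : MvPowerSeries (Fin 2) ℂ} (hconv : IsConvergent F)
    {a : PowerSeries ℂ} (hF : F.subst ![PowerSeries.X * a, PowerSeries.X] = 0)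
    (hd : MvPowerSeries.constantCoeff (MvPowerSeries.pderiv ℂ 0 F) ≠ 0) :
    IsConvergentOne a := by
  obtain ⟨r, hr, hsum⟩ := hconv
  set c : ℂ := MvPowerSeries.coeff (Finsupp.single 0 1) F with hc
  set e : ℂ := MvPowerSeries.coeff (Finsupp.single 1 1) F with he
  have hc0 : 0 < ‖c‖ := by
    rw [norm_pos_iff]
    rw [← MvPowerSeries.coeff_zero_eq_constantCoeff_apply, MvPowerSeries.coeff_pderiv] at hd
    simpa using hd
  set M : ℝ := ∑' n : Fin 2 →₀ ℕ, ‖MvPowerSeries.coeff n F‖ * r ^ n.degree with hM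
  have hM0 : 0 ≤ M := tsum_nonneg fun _ => by positivity
  -- K will bound all partial norms of a: one half of ‖c‖ K absorbs the linear term e t, the other
  -- half absorbs everything of degree at least 2.
  set K : ℝ := 1 + 2 * ‖e‖ / ‖c‖ with hK
  have hK1 : 1 ≤ K := by
    rw [hK]
    have : 0 ≤ 2 * ‖e‖ / ‖c‖ := by positivity
    linarith
  have hKe : ‖e‖ ≤ ‖c‖ * K / 2 := by
    have : ‖c‖ * K = ‖c‖ + 2 * ‖e‖ := by
      rw [hK]
      field_simp
    linarith
  -- The first bound keeps ρ K within the radius r; the second makes the part of degree at least 2,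
  -- which carries a spare factor ρ, at most ‖c‖ K / 2.
  set ρ : ℝ := min (r / K) (‖c‖ * r ^ 2 / (2 * K * (M + 1))) with hρdef
  have hK0 : 0 < K := by linarith
  have hρ : 0 < ρ := lt_min (by positivity) (by positivity)
  have hρ1 : ρ * K ≤ r := (le_div_iff₀ hK0).1 (min_le_left _ _)
  have hρ2 : K ^ 2 * ρ / r ^ 2 * M ≤ ‖c‖ * K / 2 := by
    have h1 : ρ * (2 * K * (M + 1)) ≤ ‖c‖ * r ^ 2 :=
      (le_div_iff₀ (by positivity)).1 (min_le_right _ _)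
    have h2 : K ^ 2 * ρ / r ^ 2 * M = (ρ * (2 * K * M)) * K / (2 * r ^ 2) := by
      field_simp
    have h3 : ρ * (2 * K * M) ≤ ‖c‖ * r ^ 2 :=
      le_trans (mul_le_mul_of_nonneg_left (by nlinarith) hρ.le) h1
    rw [h2, div_le_div_iff₀ (by positivity) (by positivity)]
    nlinarith [mul_le_mul_of_nonneg_right h3 hK0.le]
  refine isConvergentOne_of_partialNorm_le hρ (K := K) fun N => ?_
  induction N with
  | zero => simpa [partialNorm] using hK0.le
  | succ N ih =>
    obtain ⟨S, hS, hcoeff⟩ := coeff_mul_coeff_eq hF (N + 1)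
    -- Coefficient n + 1 is weighted by ρⁿ, because one factor t has been divided out.
    let w : (Fin 2 →₀ ℕ) → ℝ := fun d => ∑ n ∈ Finset.range (N + 1),
      ‖PowerSeries.coeff (n + 1) (PowerSeries.X ^ (d 0 + d 1) * a ^ d 0)‖ * ρ ^ n
    have h1 : ‖c‖ * partialNorm ρ (N + 1) a ≤ ∑ d ∈ S, ‖MvPowerSeries.coeff d F‖ * w d := by
      simp only [w, partialNorm, Finset.mul_sum]
      rw [Finset.sum_comm]
      refine Finset.sum_le_sum fun n hn => ?_
      rw [← mul_assoc, ← norm_mul, hcoeff n (Finset.mem_range.1 hn), norm_neg]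
      refine (mul_le_mul_of_nonneg_right (norm_sum_le _ _) (pow_nonneg hρ.le _)).trans ?_
      rw [Finset.sum_mul]
      exact Finset.sum_le_sum fun d _ => by rw [norm_mul, mul_assoc]
    have h2 : ∀ d ∈ S, ‖MvPowerSeries.coeff d F‖ * w d ≤
        (if d = Finsupp.single 1 1 then ‖e‖ else 0) +
          K ^ 2 * ρ / r ^ 2 * (‖MvPowerSeries.coeff d F‖ * r ^ d.degree) := by
      intro d hdS
      have hdeg : d.degree = d 0 + d 1 := by
        rw [Finsupp.degree_eq_sum, Fin.sum_univ_two]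
      have hpos : 0 ≤ K ^ 2 * ρ / r ^ 2 * (‖MvPowerSeries.coeff d F‖ * r ^ d.degree) := by
        positivity
      -- Degree 0 only affects the constant coefficient, which is not counted; in degree 1 only (0,
      -- 1) is left, since (1, 0) ∉ S; from degree 2 on, only the first N coefficients of a enter
      -- and the induction hypothesis bounds them.
      rcases h : d 0 + d 1 with _ | _ | m
      · have hw : w d = 0 := by
          have h0 : d 0 = 0 := by omega
          have hd1 : d 1 = 0 := by omega
          simp [w, h0, hd1, PowerSeries.coeff_one]
        rw [hw, mul_zero]
        split_ifs <;> positivity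
      · have h0 : d 0 = 0 := by
          by_contra h0
          refine hS ?_
          convert hdS
          ext i
          fin_cases i <;> simp <;> omega
        have h1' : d 1 = 1 := by omega
        have hd1 : d = Finsupp.single 1 1 := by
          ext i
          fin_cases i <;> simp <;> omega
        have hw : w d ≤ 1 := by
          simp only [w, h0, h1']
          rw [Finset.sum_range_succ']
          simp [PowerSeries.coeff_X]
        rw [if_pos hd1]
        have : ‖MvPowerSeries.coeff d F‖ * w d ≤ ‖e‖ := by
          rw [hd1] at hw ⊢
          exact mul_le_of_le_one_right (norm_nonneg _) hw
        linarith
      · have hw : w d ≤ K ^ 2 * ρ / r ^ 2 * r ^ d.degree := by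
          have h3 : w d = partialNorm ρ (N + 1) (PowerSeries.X ^ (m + 1) * a ^ d 0) := by
            refine Finset.sum_congr rfl fun n _ => ?_
            rw [h, pow_succ' _ (m + 1), mul_assoc, PowerSeries.coeff_succ_X_mul]
          rw [h3]
          refine (partialNorm_X_pow_mul_pow_le hρ.le N a m (d 0)).trans ?_
          have h4 : partialNorm ρ N a ^ d 0 ≤ K ^ (m + 2) :=
            (pow_le_pow_left₀ (partialNorm_nonneg hρ.le N a) ih _).trans
              (pow_le_pow_right₀ hK1 (by omega))
          calc ρ ^ (m + 1) * partialNorm ρ N a ^ d 0 ≤ ρ ^ (m + 1) * K ^ (m + 2) := by gcongr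
            _ = K ^ 2 * ρ * (ρ * K) ^ m := by
              rw [mul_pow]
              ring
            _ ≤ K ^ 2 * ρ * r ^ m := by gcongr
            _ = K ^ 2 * ρ / r ^ 2 * r ^ d.degree := by
              rw [hdeg, h]
              field_simp
              ring
        have h5 := mul_le_mul_of_nonneg_left hw (norm_nonneg (MvPowerSeries.coeff d F))
        refine h5.trans (le_trans (le_of_eq (by ring)) (le_add_of_nonneg_left ?_))
        split_ifs <;> positivity
    have h3 : ∑ d ∈ S, (if d = Finsupp.single 1 1 then ‖e‖ else 0) ≤ ‖e‖ := by
      rw [Finset.sum_ite_eq']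
      split_ifs
      · exact le_rfl
      · positivity
    have h4 : ∑ d ∈ S, ‖MvPowerSeries.coeff d F‖ * r ^ d.degree ≤ M :=
      hsum.sum_le_tsum S fun _ _ => by positivity
    have h5 := h1.trans (Finset.sum_le_sum h2)
    rw [Finset.sum_add_distrib, ← Finset.mul_sum] at h5
    have h6 := mul_le_mul_of_nonneg_left h4 (by positivity : 0 ≤ K ^ 2 * ρ / r ^ 2)
    refine le_of_mul_le_mul_left ?_ hc0
    linarith

end PlaneFoliation

end

/-! ### The separatrix obtained from Euler's series, and its divergence. -/

noncomputable section

namespace PlaneFoliation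

/-! ### Euler's divergent series -/

/-- The divergent series `∑ (-1)ⁿ (n + 1)! tⁿ`. -/
def eulerSeries : PowerSeries ℂ := PowerSeries.mk fun n => (-1) ^ n * ((n + 1).factorial : ℂ)

/-- At tⁿ⁺¹ this is (n + 2)(n + 1)! = (n + 2)!, with alternating signs. -/
theorem eulerSeries_ode :
    PowerSeries.X ^ 2 * PowerSeries.derivative ℂ eulerSeries +
      (2 * PowerSeries.X + 1) * eulerSeries = 1 := by
  have h : PowerSeries.X ^ 2 * PowerSeries.derivative ℂ eulerSeries +
      (2 * PowerSeries.X + 1) * eulerSeries =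
      PowerSeries.X * (PowerSeries.X * PowerSeries.derivative ℂ eulerSeries +
        (eulerSeries + eulerSeries)) + eulerSeries := by ring
  rw [h]
  ext n
  rcases n with _ | n
  · simp [eulerSeries]
  · rw [map_add, PowerSeries.coeff_succ_X_mul, PowerSeries.coeff_one, if_neg n.succ_ne_zero]
    rcases n with _ | n
    · simp [eulerSeries]
      norm_num
    · simp only [map_add, PowerSeries.coeff_succ_X_mul, PowerSeries.coeff_derivative, eulerSeries,
        PowerSeries.coeff_mk]
      rw [Nat.factorial_succ (n + 2)]
      push_cast
      ring

/-- Convergence would make n! rⁿ tend to 0, as r⁻ⁿ/n! does, although their product is 1. -/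
theorem not_isConvergentOne_eulerSeries : ¬ IsConvergentOne eulerSeries := by
  rintro ⟨r, hr, h⟩
  have h1 : Summable fun n : ℕ => (n.factorial : ℝ) * r ^ n := by
    refine h.of_nonneg_of_le (fun _ => by positivity) fun n => ?_
    gcongr
    rw [eulerSeries, PowerSeries.coeff_mk, norm_mul, norm_pow, norm_neg, norm_one, one_pow, one_mul,
      Complex.norm_natCast]
    exact_mod_cast Nat.factorial_le n.le_succ
  have h2 := h1.tendsto_atTop_zero.mul (FloorSemiring.tendsto_pow_div_factorial_atTop r⁻¹)
  have h3 : (fun n : ℕ => (n.factorial : ℝ) * r ^ n * (r⁻¹ ^ n / n.factorial)) = fun _ => 1 := by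
    funext n
    have : (n.factorial : ℝ) ≠ 0 := by positivity
    field_simp
    rw [← mul_pow, mul_one_div_cancel hr.ne', one_pow]
  rw [h3, mul_zero] at h2
  exact one_ne_zero (tendsto_nhds_unique tendsto_const_nhds h2)

/-! ### The parametrization of the separatrix -/

namespace Separatrix

open PowerSeries

/-- The quotient `y t / x` as a function of the parameter `t`. -/
def slope : ℂ⟦X⟧ := 1 - X + X ^ 3 * eulerSeries

/-- The common denominator of the coordinates. -/
def denom : ℂ⟦X⟧ := X ^ 3 + slope ^ 2 - X * slope

/-- The first coordinate of the parametrization. -/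
def abscissa : ℂ⟦X⟧ := X ^ 2 * denom⁻¹

/-- The second coordinate of the parametrization. -/
def ordinate : ℂ⟦X⟧ := X * (slope * denom⁻¹)

/-- This is the invariance condition: in terms of t = g/x² and s = ty/x the form is x⁹ ((t³ - 2t + 1
- s) dt - t³ d(s/t)). -/
theorem slope_ode : X ^ 2 * derivative ℂ slope = (X - 1) * slope + X ^ 3 - 2 * X + 1 := by
  have h : derivative ℂ slope =
      -1 + 3 * X ^ 2 * eulerSeries + X ^ 3 * derivative ℂ eulerSeries := by
    simp only [slope, map_add, map_sub, derivative_one, derivative_X, Derivation.leibniz,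
      derivative_pow, smul_eq_mul]
    push_cast
    ring
  rw [h, slope]
  linear_combination X ^ 3 * eulerSeries_ode

theorem constantCoeff_slope : constantCoeff slope = 1 := by
  simp [slope]

theorem constantCoeff_denom : constantCoeff denom = 1 := by
  simp [denom, constantCoeff_slope]

theorem denom_mul_inv : denom * denom⁻¹ = 1 :=
  PowerSeries.mul_inv_cancel _ (by simp [constantCoeff_denom])

theorem slope_mul_abscissa : slope * abscissa = X * ordinate := by
  rw [abscissa, ordinate]
  ring

/-- The parameter is t = g/x². Inserting y = sx/t into g = t x² and solving for x is what produces
`denom`. -/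
theorem conic_abscissa_ordinate :
    abscissa - ordinate ^ 2 + abscissa * ordinate = X * abscissa ^ 2 := by
  rw [abscissa, ordinate]
  have h := denom_mul_inv
  have hd : X ^ 3 + slope ^ 2 - X * slope = denom := rfl
  generalize denom⁻¹ = I at *
  linear_combination (-X ^ 2 * I) * h - X ^ 2 * I ^ 2 * hd

/-- The parametrized curve is invariant. -/
theorem omegaLocal_tangent :
    MvPolynomial.aeval ![abscissa, ordinate] (omegaLocal 0) * derivative ℂ abscissa +
      MvPolynomial.aeval ![abscissa, ordinate] (omegaLocal 1) * derivative ℂ ordinate = 0 := by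
  have e1 := slope_mul_abscissa
  have e2 := conic_abscissa_ordinate
  have d1 := congrArg (derivative ℂ) e1
  have d2 := congrArg (derivative ℂ) e2
  have e3 := slope_ode
  simp only [map_add, map_sub, Derivation.leibniz, derivative_X, derivative_pow, smul_eq_mul]
    at d1 d2
  simp only [omegaLocal, sexticGerm, conicGerm, Matrix.cons_val, map_add, map_sub, map_mul,
    map_pow, map_ofNat, MvPolynomial.aeval_X]
  rw [e2]
  generalize derivative ℂ abscissa = x' at *
  generalize derivative ℂ ordinate = y' at *
  generalize derivative ℂ slope = s' at *
  generalize abscissa = x at *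
  generalize ordinate = y at *
  generalize slope = s at *
  push_cast at d2
  have hT : (X : ℂ⟦X⟧) ≠ 0 := X_ne_zero
  generalize (X : ℂ⟦X⟧) = t at *
  -- `hc` is the sextic along the curve, `hw` computes x² d(y/x) from y/x = s/t, and `hb` says that
  -- x³ d(g/x²) = x³ dt.
  have hc : (t * x ^ 2) ^ 3 - x ^ 3 * (2 * x + y) * (t * x ^ 2) + x ^ 6 =
      x ^ 6 * (t ^ 3 - 2 * t + 1 - s) := by
    linear_combination x ^ 5 * e1
  have hw : t ^ 2 * (x * y' - y * x') = x ^ 2 * (t * s' - s) := by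
    linear_combination (t * x' + x) * e1 - t * x * d1
  have hb : (2 * y ^ 2 - x - x * y) * x' + x * (x - 2 * y) * y' = x ^ 3 := by
    linear_combination x * d2 - 2 * x' * e2
  rw [hc]
  linear_combination x ^ 6 * (t ^ 3 - 2 * t + 1 - s) * hb - t * x ^ 7 * hw - x ^ 9 * e3

theorem coeff_one_X_mul (a : ℂ⟦X⟧) : coeff 1 (X * a) = constantCoeff a := by
  rw [← zero_add 1, coeff_succ_X_mul, coeff_zero_eq_constantCoeff_apply]

theorem isUnit_coeff_one_ordinate : IsUnit (coeff 1 ordinate) := by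
  rw [ordinate, coeff_one_X_mul]
  simp [constantCoeff_slope, constantCoeff_denom]

theorem constantCoeff_ordinate : constantCoeff ordinate = 0 := by
  simp [ordinate]

/-- The parameter as a function of the second coordinate. -/
def param : ℂ⟦X⟧ := ordinate.substInvOfIsUnit isUnit_coeff_one_ordinate

theorem hasSubst_param : HasSubst param := HasSubst.substInvOfIsUnit _ _

theorem hasSubst_ordinate : HasSubst ordinate :=
  HasSubst.of_constantCoeff_zero' constantCoeff_ordinate

theorem ordinate_subst_param : ordinate.subst param = X :=
  subst_substInvOfIsUnit_right _ constantCoeff_ordinate _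

theorem param_subst_ordinate : param.subst ordinate = X :=
  subst_substInvOfIsUnit_left _ constantCoeff_ordinate _

/-- The series `h` such that the separatrix is `x = h(y)`. -/
def graph : ℂ⟦X⟧ := abscissa.subst param

theorem constantCoeff_param : constantCoeff param = 0 := constantCoeff_substInvOfIsUnit _ _

theorem exists_param_eq : ∃ ψ : ℂ⟦X⟧, param = X * ψ ∧ constantCoeff ψ ≠ 0 := by
  obtain ⟨ψ, hψ⟩ := X_dvd_iff.2 constantCoeff_param
  refine ⟨ψ, hψ, ?_⟩
  have h : coeff 1 param = _ := coeff_one_substInvOfIsUnit _ isUnit_coeff_one_ordinate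
  rw [hψ, coeff_one_X_mul] at h
  rw [h]
  exact Units.ne_zero _

/-- The series `h` is `y²` times a unit. -/
theorem exists_graph_eq : ∃ u : ℂ⟦X⟧, graph = X ^ 2 * u ∧ constantCoeff u ≠ 0 := by
  obtain ⟨ψ, hψ, h0⟩ := exists_param_eq
  have hu : denom.subst param * (denom⁻¹).subst param = 1 := by
    rw [← subst_mul hasSubst_param, denom_mul_inv, ← coe_substAlgHom hasSubst_param, map_one]
  refine ⟨ψ ^ 2 * (denom⁻¹).subst param, ?_, ?_⟩
  · rw [graph, abscissa, subst_mul hasSubst_param, subst_pow hasSubst_param,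
      subst_X hasSubst_param, hψ]
    ring
  · have h1 := congrArg constantCoeff hu
    rw [map_mul, map_one] at h1
    rw [map_mul, map_pow]
    exact mul_ne_zero (pow_ne_zero _ h0) (right_ne_zero_of_mul_eq_one h1)

theorem constantCoeff_graph : constantCoeff graph = 0 := by
  obtain ⟨u, hu, -⟩ := exists_graph_eq
  simp [hu]

/-- The relation g = t x² with y as the variable: it determines the parameter from h alone, which is
needed to carry convergence over. -/
theorem conic_graph : graph - X ^ 2 + graph * X = param * graph ^ 2 := by
  have h := congrArg (substAlgHom hasSubst_param) conic_abscissa_ordinate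
  simp only [map_add, map_sub, map_mul, map_pow, substAlgHom_X, coe_substAlgHom,
    ordinate_subst_param] at h
  exact h

/-- The differential equation satisfied by `h`. -/
theorem omegaLocal_graph :
    MvPolynomial.aeval ![graph, X] (omegaLocal 0) * derivative ℂ graph +
      MvPolynomial.aeval ![graph, X] (omegaLocal 1) = 0 := by
  have hA : ∀ p : MvPolynomial (Fin 2) ℂ,
      substAlgHom hasSubst_param (MvPolynomial.aeval ![abscissa, ordinate] p) =
        MvPolynomial.aeval ![graph, X] p := fun p => by
    rw [← AlgHom.comp_apply]
    congr 1
    refine MvPolynomial.algHom_ext fun i => ?_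
    rw [AlgHom.comp_apply, MvPolynomial.aeval_X, MvPolynomial.aeval_X, coe_substAlgHom]
    fin_cases i
    · rfl
    · exact ordinate_subst_param
  have h := congrArg (substAlgHom hasSubst_param) omegaLocal_tangent
  rw [map_add, map_mul, map_mul, hA, hA, map_zero] at h
  simp only [coe_substAlgHom] at h
  have h1 : derivative ℂ graph = (derivative ℂ abscissa).subst param * derivative ℂ param :=
    derivative_subst hasSubst_param
  have h2 : 1 = (derivative ℂ ordinate).subst param * derivative ℂ param := by
    rw [← derivative_subst hasSubst_param, ordinate_subst_param, derivative_X]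
  linear_combination derivative ℂ param * h +
    MvPolynomial.aeval ![graph, X] (omegaLocal 0) * h1 +
    MvPolynomial.aeval ![graph, X] (omegaLocal 1) * h2

/-! ### The separatrix -/

/-- The equation `x - h(y)` of the separatrix. -/
def equation : MvPowerSeries (Fin 2) ℂ := MvPowerSeries.X 0 - embed 1 graph

theorem coeff_single_equation : MvPowerSeries.coeff (Finsupp.single 0 1) equation = 1 := by
  rw [equation, map_sub, coeff_embed, if_neg, MvPowerSeries.coeff_index_single_self_X, sub_zero]
  intro h
  simpa using DFunLike.congr_fun h 0

theorem order_equation : equation.order = 1 := by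
  refine le_antisymm ?_ ?_
  · have h : MvPowerSeries.coeff (Finsupp.single 0 1) equation ≠ 0 := by
      rw [coeff_single_equation]
      exact one_ne_zero
    simpa using MvPowerSeries.order_le h
  · rw [MvPowerSeries.one_le_order_iff_constCoeff_eq_zero]
    simp [equation, constantCoeff_embed, constantCoeff_graph]

/-- Modulo x - h(y) the variable x becomes h(y); two algebra maps into the quotient agree on the
variables. -/
theorem equation_dvd_sub (p : MvPolynomial (Fin 2) ℂ) :
    equation ∣ (p : MvPowerSeries (Fin 2) ℂ) - embed 1 (MvPolynomial.aeval ![graph, X] p) := by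
  rw [← Ideal.mem_span_singleton, ← Ideal.Quotient.eq]
  let φ : MvPolynomial (Fin 2) ℂ →ₐ[ℂ] MvPowerSeries (Fin 2) ℂ ⧸ Ideal.span {equation} :=
    (Ideal.Quotient.mkₐ ℂ (Ideal.span {equation})).comp (MvPolynomial.coeToMvPowerSeries.algHom ℂ)
  let ψ : MvPolynomial (Fin 2) ℂ →ₐ[ℂ] MvPowerSeries (Fin 2) ℂ ⧸ Ideal.span {equation} :=
    (Ideal.Quotient.mkₐ ℂ (Ideal.span {equation})).comp
      ((embed 1).comp (MvPolynomial.aeval ![graph, X]))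
  have h : φ = ψ := by
    ext i
    fin_cases i
    · simp [φ, ψ]
      rw [Ideal.Quotient.eq, Ideal.mem_span_singleton, equation]
    · simp [φ, ψ, embed_X]
  have := AlgHom.congr_fun h p
  simpa [φ, ψ] using this

theorem pderiv_zero_equation : MvPowerSeries.pderiv ℂ 0 equation = 1 := by
  rw [equation, map_sub, MvPowerSeries.pderiv_X_self, pderiv_embed_of_ne (by decide), sub_zero]

theorem isFormalSeparatrix_equation : IsFormalSeparatrix omegaLocal equation := by
  refine ⟨irreducible_of_order_eq_one order_equation, ?_⟩
  have h1 : MvPowerSeries.pderiv ℂ 1 equation = -embed 1 (derivative ℂ graph) := by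
    rw [equation, map_sub, MvPowerSeries.pderiv_X_of_ne (by decide), pderiv_embed_self, zero_sub]
  have h2 := congrArg (embed 1) omegaLocal_graph
  rw [map_add, map_mul, map_zero] at h2
  have h3 := (((equation_dvd_sub (omegaLocal 0)).mul_right (-embed 1 (derivative ℂ graph))).sub
    (equation_dvd_sub (omegaLocal 1)))
  rw [pderiv_zero_equation, h1]
  convert h3 using 1
  linear_combination -h2

/-! ### Divergence -/

theorem subst_pair_embed {b c : ℂ⟦X⟧} (hb : constantCoeff b = 0) (hc : constantCoeff c = 0)
    (i : Fin 2) (k : ℂ⟦X⟧) :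
    MvPowerSeries.subst ![b, c] (embed i k) =
      k.subst ((![b, c] : Fin 2 → ℂ⟦X⟧) i) := by
  rw [embed, coe_substAlgHom, PowerSeries.subst, PowerSeries.subst,
    MvPowerSeries.subst_comp_subst_apply (HasSubst.X i).const (hasSubst_pair hb hc)]
  congr 1
  funext _
  rw [MvPowerSeries.subst_X (hasSubst_pair hb hc)]

/-- The series u · (x - h(y)) vanishes at x = h(y), and its x-derivative at the origin is u(0) ≠ 0.
-/
theorem isConvergentOne_graph {u : MvPowerSeries (Fin 2) ℂ} (hu : IsUnit u)
    (h : IsConvergent (u * equation)) : IsConvergentOne graph := by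
  obtain ⟨v, hv⟩ := X_dvd_iff.2 constantCoeff_graph
  have hconv : IsConvergentOne v := by
    refine isConvergentOne_of_subst_eq_zero h ?_ ?_
    · rw [← hv]
      have hs := hasSubst_pair constantCoeff_graph (c := X) (by simp)
      rw [MvPowerSeries.subst_mul hs, equation, MvPowerSeries.subst_sub hs,
        MvPowerSeries.subst_X hs, subst_pair_embed constantCoeff_graph (by simp)]
      simp [X_subst]
    · rw [Derivation.leibniz, map_add, smul_eq_mul, smul_eq_mul, map_mul, map_mul]
      have h1 : MvPowerSeries.constantCoeff equation = 0 := by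
        simp [equation, constantCoeff_embed, constantCoeff_graph]
      rw [pderiv_zero_equation, h1, map_one, mul_one, zero_mul, add_zero]
      exact (MvPowerSeries.isUnit_iff_constantCoeff.1 hu).ne_zero
  rw [hv]
  exact IsConvergentOne.mul (by simpa using isConvergentOne_coe Polynomial.X) hconv

/-- Write h = y² w and τ for `param`. By `conic_graph`, τ w² = (h - y² + hy)/y⁴ converges. The
ordinate y(t) solves τ(y) w(y)² - t w(y)² = 0, whose y-derivative at the origin is τ'(0) w(0)² ≠ 0;
keeping the factor w² avoids inverting it. -/
theorem isConvergentOne_ordinate (h : IsConvergentOne graph) :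
    IsConvergentOne (slope * denom⁻¹) := by
  obtain ⟨ψ, hψ, hψ0⟩ := exists_param_eq
  obtain ⟨w, hw, hw0⟩ := exists_graph_eq
  have cX : IsConvergentOne X := by simpa using isConvergentOne_coe Polynomial.X
  have cw : IsConvergentOne w := by
    rw [hw] at h
    exact h.of_X_pow_mul
  have ck : IsConvergentOne (param * w ^ 2) := by
    have h1 : X ^ 4 * (param * w ^ 2) = graph + (graph * X +
        ((Polynomial.C (-1) : Polynomial ℂ) : ℂ⟦X⟧) * (X * X)) := by
      have h2 := conic_graph
      rw [Polynomial.coe_C, map_neg, map_one]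
      rw [hw] at h2 ⊢
      linear_combination -h2
    refine IsConvergentOne.of_X_pow_mul (n := 4) ?_
    rw [h1]
    exact h.add ((h.mul cX).add ((isConvergentOne_coe _).mul (cX.mul cX)))
  have cF : IsConvergent (embed 0 (param * w ^ 2) +
      embed 1 (((Polynomial.C (-1) : Polynomial ℂ) : ℂ⟦X⟧) * X) * embed 0 (w * w)) :=
    ((isConvergent_embed_iff _ _).2 ck).add (((isConvergent_embed_iff _ _).2
      ((isConvergentOne_coe _).mul cX)).mul ((isConvergent_embed_iff _ _).2 (cw.mul cw)))
  refine isConvergentOne_of_subst_eq_zero cF ?_ ?_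
  · change MvPowerSeries.subst ![ordinate, X] _ = 0
    have hs := hasSubst_pair constantCoeff_ordinate (c := X) (by simp)
    rw [MvPowerSeries.subst_add hs, MvPowerSeries.subst_mul hs]
    simp only [subst_pair_embed constantCoeff_ordinate (c := X) (by simp)]
    simp only [Matrix.cons_val, X_subst, subst_mul hasSubst_ordinate, subst_pow hasSubst_ordinate,
      param_subst_ordinate]
    rw [Polynomial.coe_C, map_neg, map_one]
    ring
  · simp only [map_add, Derivation.leibniz, pderiv_embed_self,
      pderiv_embed_of_ne (show (0 : Fin 2) ≠ 1 by decide), smul_eq_mul, map_mul,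
      constantCoeff_embed, mul_zero, add_zero, constantCoeff_X, zero_mul]
    rw [hψ]
    simp [Derivation.leibniz, hw0, hψ0]

/-- With v = s/`denom`, the series σ = s - 1 = t(-1 + t²E) solves v(t) (t³ + (1 + σ)² - t(1 + σ)) =
1 + σ. The σ-derivative of the difference of the two sides at the origin is 2v(0) - 1 = 1. -/
theorem isConvergentOne_eulerSeries (h : IsConvergentOne (slope * denom⁻¹)) :
    IsConvergentOne eulerSeries := by
  set v := slope * denom⁻¹ with hv
  have cF : IsConvergent (embed 1 v * ((MvPolynomial.X 1 ^ 3 + (1 + MvPolynomial.X 0) ^ 2 -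
      MvPolynomial.X 1 * (1 + MvPolynomial.X 0) : MvPolynomial (Fin 2) ℂ) : MvPowerSeries _ ℂ) +
      ((-(1 + MvPolynomial.X 0) : MvPolynomial (Fin 2) ℂ) : MvPowerSeries _ ℂ)) :=
    (((isConvergent_embed_iff _ _).2 h).mul (isConvergent_coe _)).add (isConvergent_coe _)
  have h1 : IsConvergentOne (-1 + X ^ 2 * eulerSeries) := by
    refine isConvergentOne_of_subst_eq_zero cF ?_ ?_
    · have hb : constantCoeff (X * (-1 + X ^ 2 * eulerSeries)) = 0 := by simp
      have hs := hasSubst_pair hb (c := X) (by simp)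
      rw [MvPowerSeries.subst_add hs, MvPowerSeries.subst_mul hs, subst_pair_embed hb (by simp),
        MvPowerSeries.subst_coe, MvPowerSeries.subst_coe]
      simp only [Matrix.cons_val, X_subst, map_add, map_sub, map_mul, map_pow, map_neg, map_one,
        MvPolynomial.aeval_X]
      have hs1 : 1 + X * (-1 + X ^ 2 * eulerSeries) = slope := by
        rw [slope]
        ring
      have hd : X ^ 3 + slope ^ 2 - X * slope = denom := rfl
      rw [hs1, hd, hv]
      linear_combination slope * denom_mul_inv
    · rw [map_add, Derivation.leibniz, pderiv_embed_of_ne (by decide), MvPowerSeries.pderiv_coe,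
        MvPowerSeries.pderiv_coe]
      simp [MvPolynomial.pderiv_X, constantCoeff_embed, hv, constantCoeff_slope,
        constantCoeff_denom, constantCoeff_coe, map_ofNat]
      norm_num
  have h2 : X ^ 2 * eulerSeries =
      (-1 + X ^ 2 * eulerSeries) + ((1 : Polynomial ℂ) : ℂ⟦X⟧) := by
    rw [Polynomial.coe_one]
    ring
  refine IsConvergentOne.of_X_pow_mul (n := 2) ?_
  rw [h2]
  exact h1.add (isConvergentOne_coe _)

theorem isDivergentCurve_equation : IsDivergentCurve equation := fun _ hu h =>
  not_isConvergentOne_eulerSeries (isConvergentOne_eulerSeries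
    (isConvergentOne_ordinate (isConvergentOne_graph hu h)))

end Separatrix

end PlaneFoliation

end

theorem mainTheorem1 :
    -- The starting point is Euler's foliation, `y² dz + (z - y) dy` in the chart `x = 1`.
    PlaneFoliation.IsFoliation 2 PlaneFoliation.eulerForm ∧
    PlaneFoliation.localForm PlaneFoliation.eulerForm 0 ![1, 0, 0] =
      ![MvPolynomial.X 1 - MvPolynomial.X 0, MvPolynomial.X 0 ^ 2] ∧
    -- The sequence of four transformations leads to `omegaTilde`.
    (∃ ω₁ ω₂ ω₃ : PlaneFoliation.Form 3,
      PlaneFoliation.IsTransform PlaneFoliation.shift₁ PlaneFoliation.eulerForm ω₁ ∧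
      PlaneFoliation.IsTransform PlaneFoliation.rho₁ ω₁ ω₂ ∧
      PlaneFoliation.IsTransform PlaneFoliation.shift₂ ω₂ ω₃ ∧
      PlaneFoliation.IsTransform PlaneFoliation.rho₂ ω₃ PlaneFoliation.omegaTilde) ∧
    -- `omegaTilde` has degree 7 and the single singular point `(0 : 0 : 1)`.
    PlaneFoliation.IsFoliation 7 PlaneFoliation.omegaTilde ∧
    PlaneFoliation.singularSet PlaneFoliation.omegaTilde =
      {Projectivization.mk ℂ ![0, 0, 1] (fun h => one_ne_zero (congrFun h 2))} ∧
    -- Multiplicity and Milnor number of that point.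
    PlaneFoliation.multiplicity
      (PlaneFoliation.localForm PlaneFoliation.omegaTilde 2 ![0, 0, 1]) = 4 ∧
    PlaneFoliation.milnorNumber
      (PlaneFoliation.localForm PlaneFoliation.omegaTilde 2 ![0, 0, 1]) = 57 ∧
    -- There is a divergent separatrix through it.
    (∃ f : MvPowerSeries (Fin 2) ℂ,
      PlaneFoliation.IsFormalSeparatrix
        (PlaneFoliation.localForm PlaneFoliation.omegaTilde 2 ![0, 0, 1]) f ∧
      PlaneFoliation.IsDivergentCurve f) ∧
    -- The line `x = 0` is invariant.
    PlaneFoliation.IsInvariantPlaneCurve PlaneFoliation.omegaTilde (MvPolynomial.X 0) ∧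
    -- The foliation is not of second type.
    ¬ PlaneFoliation.IsSecondType PlaneFoliation.omegaTilde := by
  open PlaneFoliation in
  refine ⟨isFoliation_eulerForm, localForm_eulerForm,
    ⟨omega₁, omega₂, omega₃, isTransform_shift₁, isTransform_rho₁, isTransform_shift₂,
      isTransform_rho₂⟩,
    isFoliation_omegaTilde, singularSet_omegaTilde, ?_, ?_, ?_,
    isInvariantPlaneCurve_omegaTilde, not_isSecondType_omegaTilde⟩
  all_goals rw [PlaneFoliation.localForm_omegaTilde]
  · exact PlaneFoliation.multiplicity_omegaLocal
  · exact PlaneFoliation.milnorNumber_omegaLocal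
  · exact ⟨PlaneFoliation.Separatrix.equation,
      PlaneFoliation.Separatrix.isFormalSeparatrix_equation,
      PlaneFoliation.Separatrix.isDivergentCurve_equation⟩
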